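/- Let $\mathbb K$ be a field and $V$ a $\mathbb K$-vector space of finite positive dimension. A tridiagonal pair on $V$ is an ordered pair $A,A^*$ of linear maps $V\to V$ such that (i) $A$ and $A^*$ are diagonalizable; (ii) the eigenspaces of $A$ can be ordered as $V_0,\dots,V_d$ with $A^*V_i\subseteq V_{i-1}+V_i+V_{i+1}$ for $0\le i\le d$; (iii) the eigenspaces of $A^*$ can be ordered as $V_0^*,\dots,V_\delta^*$ with $AV_i^*\subseteq V_{i-1}^*+V_i^*+V_{i+1}^*$ for $0\le i\le\delta$ (where $V_{-1}=V_{d+1}=V^*_{-1}=V^*_{\delta+1}=0$); (iv) the only subspaces $W$ of $V$ with $AW\subseteq W$ and $A^*W\subseteq W$ are $0$ and $V$. Orderings as in (ii), (iii) are called standard. A TD system of diameter $d$ on $V$ is a sequence $\Phi=(A;\{E_i\}_{i=0}^d;A^*;\{E_i^*\}_{i=0}^d)$ where $A,A^*$ is a tridiagonal pair on $V$ and $E_0,\dots,E_d$ (resp. $E_0^*,\dots,E_d^*$) are the projections of $V$ onto the eigenspaces of $A$ (resp. $A^*$) along the sum of the other eigenspaces, taken in a standard order. Let $\theta_i$ be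 the eigenvalue of $A$ on $E_iV$. Let $\Phi$ be a TD system of diameter $d\ge 1$ on $V$. For $0\le i\le d$ put $$U_i=(E_0^*V+\cdots+E_i^*V)\cap(E_iV+\cdots+E_dV),\qquad U_i^{\Downarrow}=(E_0^*V+\cdots+E_i^*V)\cap(E_0V+\cdots+E_{d-i}V).$$ For $0\le i\le d/2$ put $K_i=(E_0^*V+\cdots+E_i^*V)\cap(E_iV+\cdots+E_{d-i}V)$. For $0\le i\le j\le d+1$ put $\tau_{ij}=(x-\theta_i)(x-\theta_{i+1})\cdots(x-\theta_{j-1})\in\mathbb K[x]$, and set $\tau_{i,i-1}=0$. For $0\le i\le d+1$ put $\vartheta_i=\sum_{h=0}^{i-1}\frac{\theta_h-\theta_{d-h}}{\theta_0-\theta_d}$. Then the sums $$V=\bigoplus_{i=0}^d U_i,\qquad V=\bigoplus_{i=0}^d U_i^{\Downarrow},\qquad V=\bigoplus_{0\le i\le d/2}\ \bigoplus_{i\le j\le d-i}\tau_{ij}(A)K_i$$ are direct and equal to $V$, and there is exactly one linear map $\Psi:V\to V$ such that $$\Psi\,\tau_{ij}(A)v=(\vartheta_j-\vartheta_i)\,\tau_{i,j-1}(A)v\qquad(0\le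 i\le d/2,\ i\le j\le d-i,\ v\in K_i).$$ Let $F_i$ (resp. $F_i^{\Downarrow}$) be the projection of $V$ onto $U_i$ (resp. $U_i^{\Downarrow}$) along the sum of the other $U_j$ (resp. $U_j^{\Downarrow}$), and let $\Delta=\sum_{h=0}^d F_h^{\Downarrow}F_h$. Then $\Delta$ and $\Psi$ commute: $\Delta\Psi=\Psi\Delta$. -/

import Mathlib

open scoped Polynomial

noncomputable section

namespace TD

variable {K : Type*} [Field K] {V : Type*} [AddCommGroup V] [Module K V]

/-- `A` is diagonalizable: `V` is spanned by the eigenspaces of `A`. -/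
def IsDiagonalizable (A : Module.End K V) : Prop :=
  (⨆ μ : K, A.eigenspace μ) = ⊤

/-- `θ 0, …, θ d` is an ordering (without repetition) of all the eigenvalues of `A` such that the
corresponding ordering `Vᵢ = A.eigenspace (θ i)` of the eigenspaces of `A` is standard with respect
to `B`, that is, `B Vᵢ ⊆ Vᵢ₋₁ + Vᵢ + Vᵢ₊₁` for `0 ≤ i ≤ d`, with `V₋₁ = 0` and `V_{d+1} = 0`. -/
structure IsStandardOrdering (A B : Module.End K V) {d : ℕ} (θ : Fin (d + 1) → K) : Prop where
  injective : Function.Injective θ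
  range_eq : Set.range θ = {μ : K | A.HasEigenvalue μ}
  tridiagonal : ∀ i : Fin (d + 1), (A.eigenspace (θ i)).map B ≤
    ⨆ (j : Fin (d + 1)) (_ : (j : ℕ) ≤ i + 1 ∧ (i : ℕ) ≤ j + 1), A.eigenspace (θ j)

/-- The ordered pair `A, B` is a tridiagonal pair on `V` (with `B` in the role of `A*`). -/
structure IsTDPair (A B : Module.End K V) : Prop where
  finiteDimensional : FiniteDimensional K V
  nontrivial : Nontrivial V
  diagonalizable_left : IsDiagonalizable A
  diagonalizable_right : IsDiagonalizable B
  exists_ordering_left : ∃ (d : ℕ) (θ : Fin (d + 1) → K), IsStandardOrdering A B θ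
  exists_ordering_right : ∃ (δ : ℕ) (θ : Fin (δ + 1) → K), IsStandardOrdering B A θ
  irreducible : ∀ W : Submodule K V, W.map A ≤ W → W.map B ≤ W → W = ⊥ ∨ W = ⊤

/-- `E i` is the primitive idempotent of `A` associated with `θ i`, for every `i`: it is the
identity on the eigenspace of `θ i` and zero on the eigenspaces of the other `θ j`. -/
def IsPrimitiveIdempotents (A : Module.End K V) {d : ℕ} (θ : Fin (d + 1) → K)
    (E : Fin (d + 1) → Module.End K V) : Prop :=
  ∀ i j : Fin (d + 1), ∀ v ∈ A.eigenspace (θ j), E i v = if i = j then v else 0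

end TD

variable (K V : Type*) [Field K] [AddCommGroup V] [Module K V]

/-- A tridiagonal system `(A; {Eᵢ}; A*; {Eᵢ*})` of diameter `d` on `V`. The eigenvalue sequence
`theta` and the dual eigenvalue sequence `thetaStar`, which are determined by the other data, are
recorded as well. -/
structure TDSystem (d : ℕ) where
  A : Module.End K V
  Astar : Module.End K V
  E : Fin (d + 1) → Module.End K V
  Estar : Fin (d + 1) → Module.End K V
  theta : Fin (d + 1) → K
  thetaStar : Fin (d + 1) → K
  isTDPair : TD.IsTDPair A Astar
  standard : TD.IsStandardOrdering A Astar theta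
  standard_star : TD.IsStandardOrdering Astar A thetaStar
  idempotents : TD.IsPrimitiveIdempotents A theta E
  idempotents_star : TD.IsPrimitiveIdempotents Astar thetaStar Estar

variable {K V}

namespace TD

/-- The projection of `V` onto `U i` along the sum of the other `U j`, for a family `U` of
subspaces of which `V` is the (internal) direct sum. The value is `0` if `U` is not such a
family. -/
def proj {ι : Type*} [DecidableEq ι] (U : ι → Submodule K V) (i : ι) : Module.End K V :=
  open scoped Classical in
  if h : Function.Bijective (DirectSum.coeLinearMap U) then
    (U i).subtype ∘ₗ DirectSum.component K ι (fun j => U j) i ∘ₗ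
      (LinearEquiv.ofBijective (DirectSum.coeLinearMap U) h).symm.toLinearMap
  else 0

theorem proj_apply_of_mem {ι : Type*} [DecidableEq ι] {U : ι → Submodule K V}
    (hU : DirectSum.IsInternal U) (i j : ι) {v : V} (hv : v ∈ U j) :
    proj U i v = if i = j then v else 0 := by
  have h : Function.Bijective (DirectSum.coeLinearMap U) := hU
  have e : (LinearEquiv.ofBijective (DirectSum.coeLinearMap U) h).symm v =
      DirectSum.lof K ι (fun j => U j) j ⟨v, hv⟩ := by
    rw [LinearEquiv.symm_apply_eq]
    simp
  simp only [proj, dif_pos h, LinearMap.comp_apply, LinearEquiv.coe_coe, e]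
  split_ifs with hij
  · subst hij
    simp [DirectSum.component.lof_self]
  · rw [DirectSum.component.of]
    simp [Ne.symm hij]

end TD

namespace TDSystem

variable {d : ℕ} (Φ : TDSystem K V d)

/-- The first split decomposition,
`Uᵢ = (E₀*V + ⋯ + Eᵢ*V) ∩ (EᵢV + ⋯ + E_dV)`. -/
def U (i : Fin (d + 1)) : Submodule K V :=
  (⨆ (h : Fin (d + 1)) (_ : h ≤ i), (Φ.Estar h).range) ⊓
    (⨆ (h : Fin (d + 1)) (_ : i ≤ h), (Φ.E h).range)

/-- The second split decomposition,
`Uᵢ^⇓ = (E₀*V + ⋯ + Eᵢ*V) ∩ (E₀V + ⋯ + E_{d-i}V)`. -/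
def Udd (i : Fin (d + 1)) : Submodule K V :=
  (⨆ (h : Fin (d + 1)) (_ : h ≤ i), (Φ.Estar h).range) ⊓
    (⨆ (h : Fin (d + 1)) (_ : (h : ℕ) + i ≤ d), (Φ.E h).range)

/-- `Fᵢ`, the projection of `V` onto `Uᵢ`. -/
def F (i : Fin (d + 1)) : Module.End K V := TD.proj Φ.U i

/-- `Fᵢ^⇓`, the projection of `V` onto `Uᵢ^⇓`. -/
def Fdd (i : Fin (d + 1)) : Module.End K V := TD.proj Φ.Udd i

/-- `Δ = ∑ₕ Fₕ^⇓ Fₕ`. -/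
def Delta : Module.End K V := ∑ h : Fin (d + 1), Φ.Fdd h * Φ.F h

/-- `τᵢⱼ = (x - θᵢ)(x - θᵢ₊₁) ⋯ (x - θⱼ₋₁)` for `0 ≤ i ≤ j ≤ d + 1`. -/
def tau (i j : ℕ) : K[X] :=
  ∏ h ∈ Finset.univ.filter (fun h : Fin (d + 1) => i ≤ (h : ℕ) ∧ (h : ℕ) < j),
    (Polynomial.X - Polynomial.C (Φ.theta h))

/-- `ϑᵢ = ∑_{h < i} (θₕ - θ_{d-h}) / (θ₀ - θ_d)` for `0 ≤ i ≤ d + 1`. -/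
def vartheta (i : ℕ) : K :=
  ∑ h ∈ Finset.univ.filter (fun h : Fin (d + 1) => (h : ℕ) < i),
    (Φ.theta h - Φ.theta h.rev) / (Φ.theta 0 - Φ.theta (Fin.last d))

/-- `Kᵢ = (E₀*V + ⋯ + Eᵢ*V) ∩ (EᵢV + ⋯ + E_{d-i}V)` for `0 ≤ i ≤ d / 2`. -/
def Ksub (i : ℕ) : Submodule K V :=
  (⨆ (h : Fin (d + 1)) (_ : (h : ℕ) ≤ i), (Φ.Estar h).range) ⊓
    (⨆ (h : Fin (d + 1)) (_ : i ≤ (h : ℕ) ∧ (h : ℕ) + i ≤ d), (Φ.E h).range)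

/-- The subspace `τᵢⱼ(A) Kᵢ`. -/
def tauK (i j : ℕ) : Submodule K V := (Φ.Ksub i).map (Polynomial.aeval Φ.A (Φ.tau i j))

/-- The index set `{(i, j) | 0 ≤ i ≤ d / 2, i ≤ j ≤ d - i}` of the refined decomposition; the
condition `i ≤ d / 2` follows from `i ≤ j` and `i + j ≤ d`. -/
abbrev RefinedIndex (d : ℕ) : Type := {p : ℕ × ℕ // p.1 ≤ p.2 ∧ p.1 + p.2 ≤ d}

/-- The defining property of `Ψ`: for `0 ≤ i ≤ d / 2`, `i ≤ j ≤ d - i` and `v ∈ Kᵢ`,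
`Ψ τᵢⱼ(A) v = (ϑⱼ - ϑᵢ) τᵢ,ⱼ₋₁(A) v`. For `j = i` the coefficient is `0`, so that the condition
says `Ψ v = 0` there, in accordance with the convention `τᵢ,ᵢ₋₁ = 0`. -/
def IsPsi (Ψ : Module.End K V) : Prop :=
  ∀ i j : ℕ, i ≤ j → i + j ≤ d → ∀ v ∈ Φ.Ksub i,
    Ψ (Polynomial.aeval Φ.A (Φ.tau i j) v) =
      (Φ.vartheta j - Φ.vartheta i) • Polynomial.aeval Φ.A (Φ.tau i (j - 1)) v

end TDSystem

end

/-! Irreducibility makes the flags `E₀*V + ⋯ + Eₙ₋₁*V` and `EₙV + ⋯ + E_dV` complementary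
(`isCompl_lowStar_high`). This gives the first split decomposition, and the second is the first for
the system with the eigenspaces of `A` reversed. Moreover `τ_{i,d-i}(A)` is a bijection from `Uᵢ`
onto `U_{d-i}` for `i ≤ d/2`, and peeling off kernels along these bijections gives the refined
decomposition.

Commutation is tested on the spanning vectors `τᵢⱼ(A)v`, `v ∈ Kᵢ`. Write `τ↓` for `τ` in the
reversed ordering. Since `τᵢⱼ` and `τ↓ᵢⱼ` are monic of the same degree, `Δ τᵢⱼ(A)v = τ↓ᵢⱼ(A)v`
(`Delta_aeval_tau`). So the claim becomes `Ψ τ↓ᵢⱼ(A)v = (ϑⱼ - ϑᵢ) τ↓ᵢ,ⱼ₋₁(A)v`: on `K[A]v`, `Ψ`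
lowers two Newton bases, one from each end of the spectrum, with the same coefficients.

This is a fact about `K[X]` (`TD.lowering_newton_reverse`). A lowering map with these coefficients
satisfies a second-order relation with multiplication by `X`, the relation is the same for both
ends, and it determines the map from its values at `1` and `X`. The input is the recurrence `θᵢ₊₁ =
βθᵢ + γ - θᵢ₋₁`, which comes from evaluating a commutator identity on `E₀*V`
(`natDegree_and_coeff`). -/

namespace TDSystem

/-! ### Symmetries of a TD system and calculus of its primitive idempotents. -/

variable {K V : Type*} [Field K] [AddCommGroup V] [Module K V] {d : ℕ} (Φ : TDSystem K V d)

/-- The TD system obtained by exchanging the roles of `A` and `A*`. -/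
def dual : TDSystem K V d where
  A := Φ.Astar
  Astar := Φ.A
  E := Φ.Estar
  Estar := Φ.E
  theta := Φ.thetaStar
  thetaStar := Φ.theta
  isTDPair :=
    { finiteDimensional := Φ.isTDPair.finiteDimensional
      nontrivial := Φ.isTDPair.nontrivial
      diagonalizable_left := Φ.isTDPair.diagonalizable_right
      diagonalizable_right := Φ.isTDPair.diagonalizable_left
      exists_ordering_left := Φ.isTDPair.exists_ordering_right
      exists_ordering_right := Φ.isTDPair.exists_ordering_left
      irreducible := fun W h₁ h₂ => Φ.isTDPair.irreducible W h₂ h₁ }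
  standard := Φ.standard_star
  standard_star := Φ.standard
  idempotents := Φ.idempotents_star
  idempotents_star := Φ.idempotents

theorem _root_.TD.IsStandardOrdering.rev {A B : Module.End K V} {θ : Fin (d + 1) → K}
    (h : TD.IsStandardOrdering A B θ) : TD.IsStandardOrdering A B (fun i => θ i.rev) where
  injective := h.injective.comp Fin.rev_injective
  range_eq := by
    rw [← h.range_eq]
    exact Fin.rev_surjective.range_comp θ
  tridiagonal := fun i => by
    refine (h.tridiagonal i.rev).trans (iSup₂_le fun j hj => ?_)
    refine le_iSup₂_of_le j.rev ?_ (by simp)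
    have := i.isLt
    have := j.isLt
    simp only [Fin.val_rev] at hj ⊢
    omega

/-- The TD system obtained by reversing the ordering of the eigenspaces of `A`. -/
def down : TDSystem K V d where
  A := Φ.A
  Astar := Φ.Astar
  E := fun i => Φ.E i.rev
  Estar := Φ.Estar
  theta := fun i => Φ.theta i.rev
  thetaStar := Φ.thetaStar
  isTDPair := Φ.isTDPair
  standard := Φ.standard.rev
  standard_star := Φ.standard_star
  idempotents := fun i j v hv => by simp [Φ.idempotents i.rev j.rev v hv]
  idempotents_star := Φ.idempotents_star

theorem iSup_eigenspace : (⨆ i, Φ.A.eigenspace (Φ.theta i)) = ⊤ := by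
  rw [eq_top_iff, ← show (⨆ μ : K, Φ.A.eigenspace μ) = ⊤ from Φ.isTDPair.diagonalizable_left]
  refine iSup_le fun μ => ?_
  by_cases h : Φ.A.HasEigenvalue μ
  · have h' : μ ∈ Set.range Φ.theta := by rw [Φ.standard.range_eq]; exact h
    obtain ⟨i, rfl⟩ := h'
    exact le_iSup (fun i => Φ.A.eigenspace (Φ.theta i)) i
  · have h' : Φ.A.eigenspace μ = ⊥ := by
      by_contra h'
      exact h h'
    rw [h']
    exact bot_le

theorem end_ext {f g : Module.End K V}
    (h : ∀ i, ∀ v ∈ Φ.A.eigenspace (Φ.theta i), f v = g v) : f = g := by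
  rw [← LinearMap.eqLocus_eq_top, eq_top_iff, ← Φ.iSup_eigenspace]
  exact iSup_le fun i v hv => h i v hv

theorem A_apply_of_mem {i : Fin (d + 1)} {v : V} (hv : v ∈ Φ.A.eigenspace (Φ.theta i)) :
    Φ.A v = Φ.theta i • v :=
  Module.End.mem_eigenspace_iff.1 hv

theorem E_mem (i : Fin (d + 1)) (v : V) : Φ.E i v ∈ Φ.A.eigenspace (Φ.theta i) := by
  have h : (⊤ : Submodule K V) ≤ (Φ.A.eigenspace (Φ.theta i)).comap (Φ.E i) := by
    rw [← Φ.iSup_eigenspace]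
    refine iSup_le fun j w hw => ?_
    rw [Submodule.mem_comap, Φ.idempotents i j w hw]
    split_ifs with hij
    · rwa [hij]
    · exact zero_mem _
  exact h (Submodule.mem_top (x := v))

theorem E_apply_E (i j : Fin (d + 1)) (v : V) :
    Φ.E i (Φ.E j v) = if i = j then Φ.E j v else 0 :=
  Φ.idempotents i j _ (Φ.E_mem j v)

theorem A_apply_E (i : Fin (d + 1)) (v : V) : Φ.A (Φ.E i v) = Φ.theta i • Φ.E i v :=
  Φ.A_apply_of_mem (Φ.E_mem i v)

theorem sum_E_apply (v : V) : ∑ i, Φ.E i v = v := by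
  have h : ∑ i, Φ.E i = 1 := Φ.end_ext fun j w hw => by
    simp [LinearMap.sum_apply, Φ.idempotents _ j w hw]
  simpa [LinearMap.sum_apply] using congrArg (fun f : Module.End K V => f v) h

theorem E_apply_A (i : Fin (d + 1)) (v : V) : Φ.E i (Φ.A v) = Φ.theta i • Φ.E i v := by
  have h : Φ.E i * Φ.A = Φ.theta i • Φ.E i := Φ.end_ext fun j w hw => by
    simp only [Module.End.mul_apply, LinearMap.smul_apply, Φ.A_apply_of_mem hw, map_smul,
      Φ.idempotents i j w hw]
    split_ifs with hij
    · rw [hij]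
    · simp
  exact congrArg (fun f : Module.End K V => f v) h

theorem E_apply_aeval (i : Fin (d + 1)) (p : K[X]) (v : V) :
    Φ.E i (Polynomial.aeval Φ.A p v) = p.eval (Φ.theta i) • Φ.E i v := by
  induction p using Polynomial.induction_on' generalizing v with
  | add p q hp hq => simp [hp, hq, add_smul]
  | monomial n a =>
    have h : ∀ n : ℕ, Φ.E i ((Φ.A ^ n) v) = Φ.theta i ^ n • Φ.E i v := fun n => by
      induction n with
      | zero => simp
      | succ n ih => rw [pow_succ', Module.End.mul_apply, E_apply_A, ih, smul_smul, pow_succ']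
    simp [Polynomial.aeval_monomial, h, smul_smul]

theorem ext_E {v w : V} (h : ∀ i, Φ.E i v = Φ.E i w) : v = w := by
  rw [← Φ.sum_E_apply v, ← Φ.sum_E_apply w]
  exact Finset.sum_congr rfl fun i _ => h i

theorem eq_zero_of_E {v : V} (h : ∀ i, Φ.E i v = 0) : v = 0 :=
  Φ.ext_E fun i => by rw [h i, map_zero]

theorem range_E (i : Fin (d + 1)) : (Φ.E i).range = Φ.A.eigenspace (Φ.theta i) := by
  refine le_antisymm ?_ fun v hv => ⟨v, by simp [Φ.idempotents i i v hv]⟩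
  rintro _ ⟨v, rfl⟩
  exact Φ.E_mem i v

theorem mem_iSup_range_E (P : Fin (d + 1) → Prop) (v : V) :
    v ∈ (⨆ (h : Fin (d + 1)) (_ : P h), (Φ.E h).range) ↔ ∀ h, ¬ P h → Φ.E h v = 0 := by
  constructor
  · intro hv h hh
    have : (⨆ (h : Fin (d + 1)) (_ : P h), (Φ.E h).range) ≤ LinearMap.ker (Φ.E h) := by
      refine iSup₂_le fun k hk => ?_
      rintro _ ⟨w, rfl⟩
      rw [LinearMap.mem_ker, E_apply_E, if_neg]
      rintro rfl
      exact hh hk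
    exact this hv
  · intro hv
    rw [← Φ.sum_E_apply v]
    refine Submodule.sum_mem _ fun h _ => ?_
    by_cases hh : P h
    · exact Submodule.mem_iSup_of_mem h (Submodule.mem_iSup_of_mem hh ⟨v, rfl⟩)
    · rw [hv h hh]
      exact zero_mem _

theorem E_Astar_E (i j : Fin (d + 1)) (h : ¬ ((i : ℕ) ≤ j + 1 ∧ (j : ℕ) ≤ i + 1)) (v : V) :
    Φ.E i (Φ.Astar (Φ.E j v)) = 0 := by
  have h₁ := Φ.standard.tridiagonal j (Submodule.mem_map_of_mem (Φ.E_mem j v))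
  simp only [← range_E] at h₁
  exact (Φ.mem_iSup_range_E _ _).1 h₁ i h

theorem E_Astar_eq_zero {i : Fin (d + 1)} {v : V}
    (h : ∀ j : Fin (d + 1), (i : ℕ) ≤ j + 1 → (j : ℕ) ≤ i + 1 → Φ.E j v = 0) :
    Φ.E i (Φ.Astar v) = 0 := by
  rw [← Φ.sum_E_apply v, map_sum, map_sum]
  refine Finset.sum_eq_zero fun j _ => ?_
  by_cases hj : (i : ℕ) ≤ j + 1 ∧ (j : ℕ) ≤ i + 1
  · rw [h j hj.1 hj.2, map_zero, map_zero]
  · exact Φ.E_Astar_E i j hj v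

theorem E_ne_zero (i : Fin (d + 1)) : Φ.E i ≠ 0 := by
  intro h
  have h₁ : Φ.A.HasEigenvalue (Φ.theta i) := by
    have : Φ.theta i ∈ {μ : K | Φ.A.HasEigenvalue μ} := by
      rw [← Φ.standard.range_eq]
      exact ⟨i, rfl⟩
    exact this
  apply h₁
  have h₂ := Φ.range_E i
  rw [h, LinearMap.range_zero] at h₂
  exact h₂.symm

/-! ### The two flags and the split decompositions. -/

/-- The subspace `EₙV + ⋯ + E_dV`. -/
def high (n : ℕ) : Submodule K V := ⨆ (h : Fin (d + 1)) (_ : n ≤ (h : ℕ)), (Φ.E h).range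

/-- The subspace `E₀*V + ⋯ + Eₙ₋₁*V`. -/
def lowStar (n : ℕ) : Submodule K V :=
  ⨆ (h : Fin (d + 1)) (_ : (h : ℕ) < n), (Φ.Estar h).range

variable {Φ}

theorem mem_high {n : ℕ} {v : V} :
    v ∈ Φ.high n ↔ ∀ h : Fin (d + 1), (h : ℕ) < n → Φ.E h v = 0 := by
  simp [high, mem_iSup_range_E]

theorem mem_lowStar {n : ℕ} {v : V} :
    v ∈ Φ.lowStar n ↔ ∀ h : Fin (d + 1), n ≤ (h : ℕ) → Φ.Estar h v = 0 := by
  refine (Φ.dual.mem_iSup_range_E (fun h => (h : ℕ) < n) v).trans ?_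
  simp only [not_lt]
  rfl

theorem mem_down_high {n : ℕ} {v : V} :
    v ∈ Φ.down.high n ↔ ∀ h : Fin (d + 1), d < (h : ℕ) + n → Φ.E h v = 0 := by
  rw [mem_high]
  constructor
  · intro H h hn
    have := H h.rev (by rw [Fin.val_rev]; omega)
    simpa [down] using this
  · intro H h hn
    exact H h.rev (by rw [Fin.val_rev]; omega)

theorem down_lowStar (n : ℕ) : Φ.down.lowStar n = Φ.lowStar n := rfl

theorem high_mono {m n : ℕ} (h : m ≤ n) : Φ.high n ≤ Φ.high m := fun _ hv =>
  mem_high.2 fun k hk => mem_high.1 hv k (hk.trans_le h)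

theorem lowStar_mono {m n : ℕ} (h : m ≤ n) : Φ.lowStar m ≤ Φ.lowStar n := fun _ hv =>
  mem_lowStar.2 fun k hk => mem_lowStar.1 hv k (h.trans hk)

theorem lowStar_zero : Φ.lowStar 0 = ⊥ :=
  (Submodule.eq_bot_iff _).2 fun _ hv =>
    Φ.dual.eq_zero_of_E fun i => mem_lowStar.1 hv i (Nat.zero_le _)

theorem high_of_lt {n : ℕ} (h : d < n) : Φ.high n = ⊥ :=
  (Submodule.eq_bot_iff _).2 fun _ hv =>
    Φ.eq_zero_of_E fun i => mem_high.1 hv i (by omega)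

theorem A_sub_mem_high {n : Fin (d + 1)} {v : V} (hv : v ∈ Φ.high n) :
    Φ.A v - Φ.theta n • v ∈ Φ.high (n + 1) :=
  mem_high.2 fun h hh => by
    rw [map_sub, map_smul, E_apply_A]
    rcases (Nat.lt_succ_iff_lt_or_eq).1 hh with hh | hh
    · rw [mem_high.1 hv h hh]
      simp
    · rw [Fin.ext hh, sub_self]

theorem A_mem_lowStar {n : ℕ} {v : V} (hv : v ∈ Φ.lowStar n) : Φ.A v ∈ Φ.lowStar (n + 1) :=
  mem_lowStar.2 fun h hh => Φ.dual.E_Astar_eq_zero fun j hj _ =>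
    mem_lowStar.1 hv j (by omega)

theorem Astar_mem_high {n : ℕ} {v : V} (hv : v ∈ Φ.high (n + 1)) : Φ.Astar v ∈ Φ.high n :=
  mem_high.2 fun h hh => Φ.E_Astar_eq_zero fun j _ hj => mem_high.1 hv j (by omega)

theorem Astar_sub_mem_lowStar {n : Fin (d + 1)} {v : V} (hv : v ∈ Φ.lowStar (n + 1)) :
    Φ.Astar v - Φ.thetaStar n • v ∈ Φ.lowStar n :=
  mem_lowStar.2 fun h hh => by
    rw [map_sub, map_smul, show Φ.Estar h (Φ.Astar v) = _ from Φ.dual.E_apply_A h v]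
    rcases hh.eq_or_lt with hh | hh
    · rw [Fin.ext hh]
      exact sub_self _
    · have h₀ : Φ.dual.E h v = 0 := mem_lowStar.1 hv h hh
      rw [mem_lowStar.1 hv h hh, h₀, smul_zero, smul_zero, sub_zero]

/-- The sum is invariant, so irreducibility applies: `A - θₙ` sends `f n` into `f (n + 1)`, and `A*
- θ*_{n+r-1}` sends `f n` into `f (n - 1)`. The case `r = 0` yields disjointness of the flags, the
case `r = 1` yields that the `Uₙ` span. -/
theorem lowStar_inf_high_step (Φ : TDSystem K V d) (f : ℕ → Submodule K V) (r : ℕ)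
    (hf : ∀ n, f n = Φ.lowStar (n + r) ⊓ Φ.high n) (hr : r ≤ 1) :
    (⨆ n, f n) = ⊥ ∨ (⨆ n, f n) = ⊤ := by
  have key : ∀ W : Submodule K V, ∀ v x : V, ∀ c : K, v ∈ W → x - c • v ∈ W → x ∈ W :=
    fun W v x c hv hx => by
      have := W.add_mem hx (W.smul_mem c hv)
      rwa [sub_add_cancel] at this
  refine Φ.isTDPair.irreducible _ ?_ ?_
  · rw [Submodule.map_iSup]
    refine iSup_le fun n => ?_
    rintro _ ⟨v, hv, rfl⟩
    by_cases hn : n < d + 1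
    · refine key _ v _ (Φ.theta ⟨n, hn⟩) (Submodule.mem_iSup_of_mem n hv) ?_
      refine Submodule.mem_iSup_of_mem (n + 1) ?_
      have hv' : v ∈ f n := hv
      rw [hf] at hv' ⊢
      refine ⟨?_, A_sub_mem_high (n := ⟨n, hn⟩) hv'.2⟩
      rw [Nat.add_right_comm]
      exact sub_mem (A_mem_lowStar hv'.1)
        (Submodule.smul_mem _ _ (lowStar_mono (Nat.le_succ _) hv'.1))
    · have hv' : v ∈ f n := hv
      rw [hf, high_of_lt (by omega), inf_bot_eq, Submodule.mem_bot] at hv'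
      rw [hv', map_zero]
      exact zero_mem _
  · rw [Submodule.map_iSup]
    refine iSup_le fun n => ?_
    rintro _ ⟨v, hv, rfl⟩
    have hv' : v ∈ f n := hv
    rw [hf] at hv'
    rcases Nat.eq_zero_or_pos (n + r) with h0 | h0
    · rw [h0, lowStar_zero, bot_inf_eq, Submodule.mem_bot] at hv'
      rw [hv', map_zero]
      exact zero_mem _
    · obtain ⟨m, hm⟩ := Nat.exists_eq_add_of_lt h0
      rw [zero_add] at hm
      by_cases hn : m < d + 1
      · refine key _ v _ (Φ.thetaStar ⟨m, hn⟩) (Submodule.mem_iSup_of_mem n hv) ?_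
        have h₁ : Φ.Astar v - Φ.thetaStar ⟨m, hn⟩ • v ∈ Φ.lowStar m :=
          Astar_sub_mem_lowStar (n := ⟨m, hn⟩) (hm ▸ hv'.1)
        rcases n with _ | n
        · obtain rfl : m = 0 := by omega
          rw [lowStar_zero, Submodule.mem_bot] at h₁
          rw [h₁]
          exact zero_mem _
        · refine Submodule.mem_iSup_of_mem n ?_
          rw [hf, show n + r = m by omega]
          exact ⟨h₁, sub_mem (Astar_mem_high hv'.2)
            (Submodule.smul_mem _ _ (high_mono (Nat.le_succ n) hv'.2))⟩
      · rw [high_of_lt (show d < n by omega), inf_bot_eq, Submodule.mem_bot] at hv'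
        rw [hv', map_zero]
        exact zero_mem _

theorem lowStar_inf_high (Φ : TDSystem K V d) (n : ℕ) : Φ.lowStar n ⊓ Φ.high n = ⊥ := by
  rcases Φ.lowStar_inf_high_step (fun n => Φ.lowStar n ⊓ Φ.high n) 0 (fun _ => rfl)
    zero_le_one with h | h
  · exact (iSup_eq_bot.1 h) n
  · exfalso
    -- The sum misses `E₀V`, since its term at `n = 0` vanishes; hence it is not all of `V`.
    have h₁ : (⨆ n, Φ.lowStar n ⊓ Φ.high n) ≤ Φ.high 1 := by
      refine iSup_le fun n => ?_
      rcases n with _ | n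
      · rw [lowStar_zero, bot_inf_eq]
        exact bot_le
      · exact inf_le_right.trans (high_mono (by omega))
    rw [h] at h₁
    exact Φ.E_ne_zero 0 (LinearMap.ext fun v => mem_high.1 (h₁ Submodule.mem_top) 0 Nat.one_pos)

theorem iSup_lowStar_inf_high (Φ : TDSystem K V d) :
    (⨆ n, Φ.lowStar (n + 1) ⊓ Φ.high n) = ⊤ := by
  rcases Φ.lowStar_inf_high_step (fun n => Φ.lowStar (n + 1) ⊓ Φ.high n) 1 (fun _ => rfl)
    le_rfl with h | h
  · exfalso
    have h₀ := (iSup_eq_bot.1 h) 0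
    refine Φ.dual.E_ne_zero 0 (LinearMap.ext fun v => ?_)
    -- The term at `n = 0` is `E₀*V`, which is nonzero.
    have : Φ.Estar 0 v ∈ Φ.lowStar (0 + 1) ⊓ Φ.high 0 := by
      refine ⟨mem_lowStar.2 fun h hh => ?_, mem_high.2 fun h hh => absurd hh (Nat.not_lt_zero _)⟩
      refine (Φ.dual.E_apply_E h 0 v).trans (if_neg ?_)
      rintro rfl
      simp at hh
    rw [h₀, Submodule.mem_bot] at this
    exact this
  · exact h

theorem isCompl_lowStar_high (Φ : TDSystem K V d) (n : ℕ) :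
    IsCompl (Φ.lowStar n) (Φ.high n) := by
  refine ⟨disjoint_iff.2 (Φ.lowStar_inf_high n), codisjoint_iff.2 (eq_top_iff.2 ?_)⟩
  rw [← Φ.iSup_lowStar_inf_high]
  refine iSup_le fun m => ?_
  rcases lt_or_ge m n with h | h
  · exact (inf_le_left.trans (lowStar_mono h)).trans le_sup_left
  · exact (inf_le_right.trans (high_mono h)).trans le_sup_right

theorem U_eq (Φ : TDSystem K V d) (i : Fin (d + 1)) :
    Φ.U i = Φ.lowStar (i + 1) ⊓ Φ.high i := by
  simp only [U, lowStar, high, Fin.le_def, Nat.lt_succ_iff]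

theorem Udd_eq (Φ : TDSystem K V d) : Φ.Udd = Φ.down.U := by
  ext i v
  rw [U_eq, Submodule.mem_inf, mem_down_high, mem_lowStar, Udd, Submodule.mem_inf,
    mem_iSup_range_E, show (v ∈ ⨆ (h : Fin (d + 1)) (_ : h ≤ i), (Φ.Estar h).range) ↔ _ from
      Φ.dual.mem_iSup_range_E _ v]
  simp only [not_le, Fin.lt_def, Nat.succ_le_iff]
  rfl

theorem U_le_lowStar (Φ : TDSystem K V d) {i : Fin (d + 1)} {n : ℕ} (h : (i : ℕ) < n) :
    Φ.U i ≤ Φ.lowStar n := by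
  rw [U_eq]
  exact inf_le_left.trans (lowStar_mono h)

theorem U_le_high (Φ : TDSystem K V d) {i : Fin (d + 1)} {n : ℕ} (h : n ≤ i) :
    Φ.U i ≤ Φ.high n := by
  rw [U_eq]
  exact inf_le_right.trans (high_mono h)

theorem iSup_U (Φ : TDSystem K V d) : (⨆ i, Φ.U i) = ⊤ := by
  rw [eq_top_iff, ← Φ.iSup_lowStar_inf_high]
  refine iSup_le fun n => ?_
  by_cases hn : n < d + 1
  · exact (Φ.U_eq ⟨n, hn⟩).ge.trans (le_iSup Φ.U ⟨n, hn⟩)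
  · rw [high_of_lt (by omega), inf_bot_eq]
    exact bot_le

theorem isInternal_U (Φ : TDSystem K V d) : DirectSum.IsInternal Φ.U := by
  refine DirectSum.isInternal_submodule_of_iSupIndep_of_iSup_eq_top ?_ Φ.iSup_U
  intro i
  have hle : (⨆ (j) (_ : j ≠ i), Φ.U j) ≤ Φ.lowStar i ⊔ Φ.high (i + 1) := by
    refine iSup₂_le fun j hj => ?_
    rcases lt_or_gt_of_ne hj with h | h
    · exact (Φ.U_le_lowStar (n := i) h).trans le_sup_left
    · exact (Φ.U_le_high (n := i + 1) h).trans le_sup_right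
  rw [Submodule.disjoint_def]
  intro v hv hv'
  obtain ⟨l, hl, h, hh, rfl⟩ := Submodule.mem_sup.1 (hle hv')
  rw [U_eq] at hv
  have hh0 : h ∈ Φ.lowStar (i + 1) ⊓ Φ.high (i + 1) :=
    ⟨(Submodule.add_mem_iff_right _ (lowStar_mono (Nat.le_succ _) hl)).1 hv.1, hh⟩
  rw [lowStar_inf_high, Submodule.mem_bot] at hh0
  subst hh0
  rw [add_zero] at hv ⊢
  have : l ∈ Φ.lowStar i ⊓ Φ.high i := ⟨hl, hv.2⟩
  rwa [lowStar_inf_high, Submodule.mem_bot] at this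

theorem lowStar_le_iSup_U (Φ : TDSystem K V d) (n : ℕ) :
    Φ.lowStar n ≤ ⨆ (i : Fin (d + 1)) (_ : (i : ℕ) < n), Φ.U i := by
  intro v hv
  have hle : (⨆ i, Φ.U i) ≤ (⨆ (i : Fin (d + 1)) (_ : (i : ℕ) < n), Φ.U i) ⊔ Φ.high n := by
    refine iSup_le fun i => ?_
    rcases lt_or_ge (i : ℕ) n with h | h
    · exact le_sup_of_le_left (le_iSup₂_of_le i h le_rfl)
    · exact le_sup_of_le_right (Φ.U_le_high h)
  rw [iSup_U] at hle
  obtain ⟨l, hl, h, hh, rfl⟩ := Submodule.mem_sup.1 (hle (Submodule.mem_top (x := v)))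
  have hl' : l ∈ Φ.lowStar n :=
    (iSup₂_le fun i hi => Φ.U_le_lowStar hi : (⨆ (i : Fin (d + 1)) (_ : (i : ℕ) < n), Φ.U i) ≤ _) hl
  have hh0 : h ∈ Φ.lowStar n ⊓ Φ.high n := ⟨(Submodule.add_mem_iff_right _ hl').1 hv, hh⟩
  rw [lowStar_inf_high, Submodule.mem_bot] at hh0
  rwa [hh0, add_zero]

theorem F_apply_of_mem_U (Φ : TDSystem K V d) (i j : Fin (d + 1)) {v : V} (hv : v ∈ Φ.U j) :
    Φ.F i v = if i = j then v else 0 :=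
  TD.proj_apply_of_mem Φ.isInternal_U i j hv

theorem F_apply_of_mem_lowStar (Φ : TDSystem K V d) (i : Fin (d + 1)) {v : V}
    (hv : v ∈ Φ.lowStar i) : Φ.F i v = 0 := by
  have : (⨆ (j : Fin (d + 1)) (_ : (j : ℕ) < i), Φ.U j) ≤ LinearMap.ker (Φ.F i) := by
    refine iSup₂_le fun j hj w hw => ?_
    rw [LinearMap.mem_ker, Φ.F_apply_of_mem_U i j hw, if_neg]
    rintro rfl
    exact lt_irrefl _ hj
  exact this (Φ.lowStar_le_iSup_U i hv)

theorem Fdd_eq (Φ : TDSystem K V d) : Φ.Fdd = Φ.down.F := by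
  funext i
  rw [Fdd, Udd_eq, F]

/-- `Δ` maps `u ∈ Uᵢ` to the element of `Uᵢ^⇓` that agrees with `u` modulo lower terms. -/
theorem Delta_apply (Φ : TDSystem K V d) (i : Fin (d + 1)) {u w : V} (hu : u ∈ Φ.U i)
    (hw : w ∈ Φ.down.U i) (huw : u - w ∈ Φ.lowStar i) : Φ.Delta u = w := by
  have h₁ : Φ.Delta u = Φ.Fdd i u := by
    rw [Delta, LinearMap.sum_apply, Finset.sum_eq_single i]
    · rw [Module.End.mul_apply, Φ.F_apply_of_mem_U i i hu, if_pos rfl]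
    · intro j _ hj
      rw [Module.End.mul_apply, Φ.F_apply_of_mem_U j i hu, if_neg hj, map_zero]
    · simp
  have h₂ := Φ.down.F_apply_of_mem_lowStar i (v := u - w) huw
  rw [map_sub, Φ.down.F_apply_of_mem_U i i hw, if_pos rfl, sub_eq_zero] at h₂
  rw [h₁, Fdd_eq, h₂]

end TDSystem

/-! ### Polynomials in `A` acting on the split decomposition. -/

namespace TDSystem

variable {K V : Type*} [Field K] [AddCommGroup V] [Module K V] {d : ℕ} {Φ : TDSystem K V d}

theorem tau_mul_tau (Φ : TDSystem K V d) {i j k : ℕ} (hij : i ≤ j) (hjk : j ≤ k) :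
    Φ.tau i j * Φ.tau j k = Φ.tau i k := by
  simp only [tau, Finset.prod_filter]
  rw [← Finset.prod_mul_distrib]
  refine Finset.prod_congr rfl fun h _ => ?_
  split_ifs <;> first | omega | simp

theorem eval_tau_eq_zero {i j : ℕ} {h : Fin (d + 1)} (h₁ : i ≤ h) (h₂ : (h : ℕ) < j) :
    (Φ.tau i j).eval (Φ.theta h) = 0 := by
  rw [tau, Polynomial.eval_prod]
  exact Finset.prod_eq_zero (i := h) (by simp [h₁, h₂]) (by simp)

theorem eval_tau_ne_zero {i j : ℕ} {h : Fin (d + 1)} (h₁ : ¬ (i ≤ (h : ℕ) ∧ (h : ℕ) < j)) :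
    (Φ.tau i j).eval (Φ.theta h) ≠ 0 := by
  rw [tau, Polynomial.eval_prod, Finset.prod_ne_zero_iff]
  intro k hk
  rw [Polynomial.eval_sub, Polynomial.eval_X, Polynomial.eval_C, sub_ne_zero]
  intro hhk
  rw [Φ.standard.injective hhk] at h₁
  exact h₁ (Finset.mem_filter.1 hk).2

theorem tau_eq_prod_Ico (t : ℕ → K) (ht : ∀ h : Fin (d + 1), t h = Φ.theta h) (i : ℕ) {j : ℕ}
    (hj : j ≤ d + 1) :
    Φ.tau i j = ∏ k ∈ Finset.Ico i j, (Polynomial.X - Polynomial.C (t k)) := by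
  rw [tau, Finset.prod_filter]
  simp only [← ht]
  rw [Fin.prod_univ_eq_prod_range
    (fun k => if i ≤ k ∧ k < j then (Polynomial.X - Polynomial.C (t k) : K[X]) else 1),
    ← Finset.prod_filter]
  refine Finset.prod_congr ?_ fun _ _ => rfl
  ext k
  simp only [Finset.mem_filter, Finset.mem_range, Finset.mem_Ico]
  omega

theorem tau_monic (Φ : TDSystem K V d) (i j : ℕ) : (Φ.tau i j).Monic :=
  Polynomial.monic_prod_of_monic _ _ fun _ _ => Polynomial.monic_X_sub_C _

theorem natDegree_tau (Φ : TDSystem K V d) (i : ℕ) {j : ℕ} (hj : j ≤ d + 1) :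
    (Φ.tau i j).natDegree = j - i := by
  rw [tau_eq_prod_Ico (fun k => if h : k < d + 1 then Φ.theta ⟨k, h⟩ else 0)
    (fun h => dif_pos h.isLt) i hj, Polynomial.natDegree_prod_of_monic _ _
    fun _ _ => Polynomial.monic_X_sub_C _]
  simp

theorem tau_self (Φ : TDSystem K V d) (i : ℕ) : Φ.tau i i = 1 := by
  rw [tau, Finset.prod_filter]
  exact Finset.prod_eq_one fun h _ => if_neg (by omega)

theorem aeval_mem_lowStar {n m : ℕ} {v : V} (hv : v ∈ Φ.lowStar n) {p : K[X]}
    (hp : p.natDegree ≤ m) : Polynomial.aeval Φ.A p v ∈ Φ.lowStar (n + m) := by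
  have h : ∀ k, (Φ.A ^ k) v ∈ Φ.lowStar (n + k) := fun k => by
    induction k with
    | zero => exact hv
    | succ k ih =>
      rw [pow_succ', Module.End.mul_apply]
      exact A_mem_lowStar ih
  rw [Polynomial.aeval_eq_sum_range' (Nat.lt_succ_of_le hp), LinearMap.sum_apply]
  refine Submodule.sum_mem _ fun k hk => Submodule.smul_mem _ _ ?_
  exact lowStar_mono (by have := Finset.mem_range.1 hk; omega) (h k)

theorem aeval_sub_mem_lowStar {n : ℕ} {v : V} (hv : v ∈ Φ.lowStar (n + 1)) {p q : K[X]}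
    (hp : p.Monic) (hq : q.Monic) (hpq : p.natDegree = q.natDegree) :
    Polynomial.aeval Φ.A p v - Polynomial.aeval Φ.A q v ∈ Φ.lowStar (n + p.natDegree) := by
  rw [← LinearMap.sub_apply, ← map_sub]
  have hdeg : p.degree = q.degree := by
    rw [Polynomial.degree_eq_natDegree hp.ne_zero, Polynomial.degree_eq_natDegree hq.ne_zero, hpq]
  by_cases h0 : p - q = 0
  · simp [h0]
  have hlt : (p - q).natDegree < p.natDegree :=
    Polynomial.natDegree_lt_natDegree h0
      (Polynomial.degree_sub_lt_left hdeg hp.ne_zero (by rw [hp.leadingCoeff, hq.leadingCoeff]))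
  exact lowStar_mono (by omega) (aeval_mem_lowStar hv le_rfl)

/-- The split decomposition, indexed by all natural numbers. -/
def split (Φ : TDSystem K V d) (n : ℕ) : Submodule K V := Φ.lowStar (n + 1) ⊓ Φ.high n

theorem aeval_tau_mem_split {i j : ℕ} (hij : i ≤ j) (hj : j ≤ d + 1) {v : V}
    (hv : v ∈ Φ.split i) : Polynomial.aeval Φ.A (Φ.tau i j) v ∈ Φ.split j := by
  refine ⟨?_, mem_high.2 fun h hh => ?_⟩
  · exact lowStar_mono (by omega) (aeval_mem_lowStar hv.1 (Φ.natDegree_tau i hj).le)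
  · rw [E_apply_aeval]
    rcases lt_or_ge (h : ℕ) i with h₁ | h₁
    · rw [mem_high.1 hv.2 h h₁, smul_zero]
    · rw [eval_tau_eq_zero h₁ hh, zero_smul]

theorem E_eq_zero_of_aeval_tau {i j : ℕ} {v : V} (hv : Polynomial.aeval Φ.A (Φ.tau i j) v = 0)
    {h : Fin (d + 1)} (hh : ¬ (i ≤ (h : ℕ) ∧ (h : ℕ) < j)) : Φ.E h v = 0 := by
  have := Φ.E_apply_aeval h (Φ.tau i j) v
  rw [hv, map_zero] at this
  exact (smul_eq_zero.1 this.symm).resolve_left (eval_tau_ne_zero hh)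

/-- A kernel vector has components only in `EᵢV, …, Eⱼ₋₁V`, hence only in `E₀V, …, E_{d-i-1}V`. The
flag of the reversed system that these span meets `E₀*V + ⋯ + Eᵢ*V` trivially. -/
theorem eq_zero_of_aeval_tau {i j : ℕ} (hij : i + j ≤ d) {v : V} (hv : v ∈ Φ.split i)
    (h0 : Polynomial.aeval Φ.A (Φ.tau i j) v = 0) : v = 0 := by
  have : v ∈ Φ.down.lowStar (i + 1) ⊓ Φ.down.high (i + 1) :=
    ⟨hv.1, mem_down_high.2 fun h hh => E_eq_zero_of_aeval_tau h0 (by omega)⟩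
  rwa [lowStar_inf_high, Submodule.mem_bot] at this

/-- The flags being complementary for both orderings, `dim Uₙ` can be written in terms of the
dimensions of the `A`-flag alone, in a formula symmetric in `n` and `d - n`. -/
theorem finrank_split (Φ : TDSystem K V d) {n : ℕ} (hn : n ≤ d) :
    Module.finrank K (Φ.split n) = Module.finrank K (Φ.split (d - n)) := by
  have := Φ.isTDPair.finiteDimensional
  have key : ∀ n ≤ d, Module.finrank K (Φ.split n) + Module.finrank K V =
      Module.finrank K (Φ.high (d - n)) + Module.finrank K (Φ.high n) := fun n hn => by
    have h₁ := Submodule.finrank_sup_add_finrank_inf_eq (Φ.lowStar (n + 1)) (Φ.high n)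
    have h₂ : Φ.lowStar (n + 1) ⊔ Φ.high n = ⊤ := by
      rw [eq_top_iff, ← (Φ.isCompl_lowStar_high n).sup_eq_top]
      exact sup_le_sup_right (lowStar_mono (Nat.le_succ n)) _
    have h₃ := Submodule.finrank_add_eq_of_isCompl (Φ.down.isCompl_lowStar_high (n + 1))
    have h₄ : IsCompl (Φ.down.high (n + 1)) (Φ.high (d - n)) := by
      refine ⟨?_, ?_⟩
      · rw [Submodule.disjoint_def]
        intro v hv hv'
        refine Φ.eq_zero_of_E fun h => ?_
        rcases lt_or_ge (h : ℕ) (d - n) with hh | hh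
        · exact mem_high.1 hv' h hh
        · exact mem_down_high.1 hv h (by omega)
      · rw [codisjoint_iff, eq_top_iff]
        intro v _
        rw [← Φ.sum_E_apply v]
        refine Submodule.sum_mem _ fun k _ => ?_
        rcases lt_or_ge (k : ℕ) (d - n) with hh | hh
        · refine Submodule.mem_sup_left (mem_down_high.2 fun h hh' => ?_)
          rw [E_apply_E, if_neg]
          rintro rfl
          omega
        · refine Submodule.mem_sup_right (mem_high.2 fun h hh' => ?_)
          rw [E_apply_E, if_neg]
          rintro rfl
          omega
    have h₄' := Submodule.finrank_add_eq_of_isCompl h₄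
    rw [h₂, finrank_top] at h₁
    rw [down_lowStar] at h₃
    rw [split]
    omega
  have h₁ := key n hn
  have h₂ := key (d - n) (Nat.sub_le _ _)
  rw [Nat.sub_sub_self hn] at h₂
  omega

/-- Injectivity together with equality of dimensions forces surjectivity. -/
theorem exists_aeval_tau_eq {i : ℕ} (hi : i + i ≤ d) {v : V} (hv : v ∈ Φ.split (d - i)) :
    ∃ w ∈ Φ.split i, Polynomial.aeval Φ.A (Φ.tau i (d - i)) w = v := by
  have := Φ.isTDPair.finiteDimensional
  let f : Φ.split i →ₗ[K] Φ.split (d - i) :=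
    (Polynomial.aeval Φ.A (Φ.tau i (d - i))).restrict
      fun w hw => aeval_tau_mem_split (by omega) (by omega) hw
  have hf : Function.Injective f := by
    rw [← LinearMap.ker_eq_bot, LinearMap.ker_eq_bot']
    intro w hw
    exact Subtype.ext (eq_zero_of_aeval_tau (by omega) w.2 (congrArg Subtype.val hw))
  obtain ⟨w, hw⟩ := (LinearMap.injective_iff_surjective_of_finrank_eq_finrank
    (Φ.finrank_split (by omega))).1 hf ⟨v, hv⟩
  exact ⟨w, w.2, congrArg Subtype.val hw⟩

/-! ### The refined decomposition and the existence of `Ψ`. -/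

theorem mem_Ksub {i : ℕ} {v : V} : v ∈ Φ.Ksub i ↔ v ∈ Φ.lowStar (i + 1) ∧
    ∀ h : Fin (d + 1), ¬ (i ≤ (h : ℕ) ∧ (h : ℕ) + i ≤ d) → Φ.E h v = 0 := by
  rw [Ksub, Submodule.mem_inf, mem_iSup_range_E]
  simp only [lowStar, Nat.lt_succ_iff]

theorem Ksub_le_split (Φ : TDSystem K V d) (i : ℕ) : Φ.Ksub i ≤ Φ.split i := fun _ hv =>
  ⟨(mem_Ksub.1 hv).1, mem_high.2 fun h hh => (mem_Ksub.1 hv).2 h (by omega)⟩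

theorem mem_Ksub_of_aeval_tau {i : ℕ} {v : V} (hv : v ∈ Φ.split i)
    (h0 : Polynomial.aeval Φ.A (Φ.tau i (d + 1 - i)) v = 0) : v ∈ Φ.Ksub i :=
  mem_Ksub.2 ⟨hv.1, fun _ hh => E_eq_zero_of_aeval_tau h0 (by omega)⟩

theorem aeval_tau_Ksub {i : ℕ} {v : V} (hv : v ∈ Φ.Ksub i) :
    Polynomial.aeval Φ.A (Φ.tau i (d + 1 - i)) v = 0 :=
  Φ.eq_zero_of_E fun h => by
    rw [E_apply_aeval]
    by_cases hh : i ≤ (h : ℕ) ∧ (h : ℕ) + i ≤ d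
    · rw [eval_tau_eq_zero hh.1 (by omega), zero_smul]
    · rw [(mem_Ksub.1 hv).2 h hh, smul_zero]

theorem down_Ksub (Φ : TDSystem K V d) (i : ℕ) : Φ.down.Ksub i = Φ.Ksub i := by
  ext v
  rw [mem_Ksub, mem_Ksub]
  refine and_congr Iff.rfl ⟨fun H h hh => ?_, fun H h hh => ?_⟩
  · have := H h.rev (by rw [Fin.val_rev]; omega)
    simpa [down] using this
  · exact H h.rev (by rw [Fin.val_rev]; omega)

theorem aeval_mul_apply (p q : K[X]) (v : V) :
    Polynomial.aeval Φ.A (p * q) v = Polynomial.aeval Φ.A p (Polynomial.aeval Φ.A q v) := by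
  rw [map_mul, Module.End.mul_apply]

theorem map_tauK (Φ : TDSystem K V d) {i j k : ℕ} (hij : i ≤ j) (hjk : j ≤ k) :
    (Φ.tauK i j).map (Polynomial.aeval Φ.A (Φ.tau j k)) = Φ.tauK i k := by
  rw [tauK, tauK, ← Submodule.map_comp, ← Φ.tau_mul_tau hij hjk, mul_comm, map_mul]
  rfl

/-- In the lower half, `Uⱼ₊₁ = Kⱼ₊₁ + (A - θⱼ)Uⱼ`: the image of `Uⱼ₊₁` under `τ_{j+1,d-j}(A)` lies
in `U_{d-j} = τ_{j,d-j}(A)Uⱼ`, and `Kⱼ₊₁` is the kernel of `τ_{j+1,d-j}(A)` on `Uⱼ₊₁`. -/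
theorem split_le_iSup_tauK (Φ : TDSystem K V d) {j : ℕ} (hj : j + j ≤ d) :
    Φ.split j ≤ ⨆ (i : ℕ) (_ : i ≤ j), Φ.tauK i j := by
  induction j with
  | zero =>
    intro v hv
    refine Submodule.mem_iSup_of_mem 0 (Submodule.mem_iSup_of_mem le_rfl ?_)
    refine ⟨v, mem_Ksub_of_aeval_tau hv (Φ.eq_zero_of_E fun h => ?_), by simp [tau_self]⟩
    rw [E_apply_aeval, eval_tau_eq_zero (Nat.zero_le _) (by omega), zero_smul]
  | succ j ih =>
    intro v hv
    have h₁ : Polynomial.aeval Φ.A (Φ.tau (j + 1) (d - j)) v ∈ Φ.split (d - j) :=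
      aeval_tau_mem_split (by omega) (by omega) hv
    obtain ⟨w, hw, hwv⟩ := exists_aeval_tau_eq (by omega) h₁
    have h₂ : v - Polynomial.aeval Φ.A (Φ.tau j (j + 1)) w ∈ Φ.Ksub (j + 1) := by
      refine mem_Ksub_of_aeval_tau
        (sub_mem hv (aeval_tau_mem_split (Nat.le_succ j) (by omega) hw)) ?_
      rw [map_sub, ← aeval_mul_apply, mul_comm, Φ.tau_mul_tau (Nat.le_succ j) (by omega),
        show d + 1 - (j + 1) = d - j by omega, hwv, sub_self]
    rw [← sub_add_cancel v (Polynomial.aeval Φ.A (Φ.tau j (j + 1)) w)]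
    refine add_mem ?_ ?_
    · exact Submodule.mem_iSup_of_mem (j + 1) (Submodule.mem_iSup_of_mem le_rfl
        ⟨_, h₂, by simp [tau_self]⟩)
    · have h₃ := Submodule.mem_map_of_mem (f := Polynomial.aeval Φ.A (Φ.tau j (j + 1)))
        (ih (by omega) hw)
      simp only [Submodule.map_iSup] at h₃
      refine SetLike.le_def.1 (iSup₂_le fun i hi => ?_) h₃
      rw [Φ.map_tauK hi (Nat.le_succ j)]
      exact le_iSup₂_of_le i (hi.trans (Nat.le_succ j)) le_rfl

theorem iSup_tauK (Φ : TDSystem K V d) :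
    (⨆ p : RefinedIndex d, Φ.tauK p.1.1 p.1.2) = ⊤ := by
  rw [eq_top_iff, ← Φ.iSup_U]
  refine iSup_le fun j => ?_
  rw [U_eq]
  change Φ.split j ≤ _
  rcases le_or_gt ((j : ℕ) + j) d with hj | hj
  · refine (Φ.split_le_iSup_tauK hj).trans (iSup₂_le fun i hi => ?_)
    exact le_iSup_of_le (⟨(i, j), hi, by simp only; omega⟩ : RefinedIndex d) le_rfl
  · intro v hv
    -- In the upper half, `Uⱼ` is the image of `U_{d-j}` under `τ_{d-j,j}(A)`.
    rw [show (j : ℕ) = d - (d - j) by omega] at hv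
    obtain ⟨w, hw, rfl⟩ := exists_aeval_tau_eq (by omega) hv
    have h₃ := Submodule.mem_map_of_mem (f := Polynomial.aeval Φ.A (Φ.tau (d - j) (d - (d - j))))
      (Φ.split_le_iSup_tauK (by omega) hw)
    simp only [Submodule.map_iSup] at h₃
    refine SetLike.le_def.1 (iSup₂_le fun i hi => ?_) h₃
    rw [Φ.map_tauK hi (by omega)]
    exact le_iSup_of_le (⟨(i, d - (d - j)), by simp only; omega, by simp only; omega⟩ :
      RefinedIndex d) le_rfl

theorem eq_zero_of_sum_tauK (Φ : TDSystem K V d) {j : ℕ} (s : Finset ℕ)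
    (hs : ∀ i ∈ s, i ≤ j ∧ i + j ≤ d) (f : ℕ → V) (hf : ∀ i ∈ s, f i ∈ Φ.tauK i j)
    (h0 : ∑ i ∈ s, f i = 0) : ∀ i ∈ s, f i = 0 := by
  intro i
  induction i using Nat.strong_induction_on with
  | _ i ih =>
  intro hi
  obtain ⟨hij, hijd⟩ := hs i hi
  -- This operator isolates the smallest remaining index: it is injective on `τᵢⱼ(A)Kᵢ`, and it
  -- kills the terms with `k > i` because `τ_{k,d-i}` is then divisible by `τ_{k,d+1-k}`, which
  -- annihilates `Kₖ`.
  have h₁ := congrArg (Polynomial.aeval Φ.A (Φ.tau j (d - i))) h0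
  rw [map_zero, map_sum, Finset.sum_eq_single i] at h₁
  · obtain ⟨v, hv, hvf⟩ := hf i hi
    rw [← hvf, ← aeval_mul_apply, mul_comm, Φ.tau_mul_tau hij (by omega)] at h₁
    rw [← hvf, eq_zero_of_aeval_tau (by omega) (Φ.Ksub_le_split i hv) h₁, map_zero]
  · intro k hk hki
    rcases lt_or_gt_of_ne hki with hlt | hgt
    · rw [ih k hlt hk, map_zero]
    · obtain ⟨v, hv, hvf⟩ := hf k hk
      obtain ⟨hkj, hkjd⟩ := hs k hk
      rw [← hvf, ← aeval_mul_apply, mul_comm, Φ.tau_mul_tau hkj (by omega),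
        ← Φ.tau_mul_tau (j := d + 1 - k) (by omega) (by omega), mul_comm, aeval_mul_apply,
        aeval_tau_Ksub hv, map_zero]
  · exact fun h => absurd hi h

theorem isInternal_tauK (Φ : TDSystem K V d) :
    DirectSum.IsInternal (fun p : RefinedIndex d => Φ.tauK p.1.1 p.1.2) := by
  refine DirectSum.isInternal_submodule_of_iSupIndep_of_iSup_eq_top ?_ Φ.iSup_tauK
  rw [iSupIndep_iff_finsetSum_eq_zero_imp_eq_zero]
  intro s f hf h0 p hp
  obtain ⟨⟨i, j⟩, hij, hijd⟩ := p
  simp only at hij hijd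
  have hU : ∀ q ∈ s, f q ∈ Φ.U ⟨q.1.2, by have := q.2; omega⟩ := fun q hq => by
    rw [U_eq]
    obtain ⟨v, hv, hvf⟩ := hf q hq
    rw [← hvf]
    exact aeval_tau_mem_split q.2.1 (by have := q.2; omega) (Φ.Ksub_le_split _ hv)
  -- As `τᵢⱼ(A)Kᵢ ⊆ Uⱼ`, projecting to `Uⱼ` reduces to a relation with `j` fixed.
  have h₁ := congrArg (Φ.F ⟨j, by omega⟩) h0
  rw [map_zero, map_sum, Finset.sum_congr rfl fun q hq => Φ.F_apply_of_mem_U _ _ (hU q hq),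
    ← Finset.sum_filter] at h₁
  let g : ℕ → V := fun k => if hk : k ≤ j ∧ k + j ≤ d then f ⟨(k, j), hk⟩ else 0
  have hg : ∀ q : RefinedIndex d, q.1.2 = j → f q = g q.1.1 := by
    rintro ⟨⟨k, l⟩, hk⟩ hl
    obtain rfl : l = j := hl
    simp only [g]
    rw [dif_pos hk]
  have key := Φ.eq_zero_of_sum_tauK (j := j)
    ((s.filter fun q => (⟨j, by omega⟩ : Fin (d + 1)) = ⟨q.1.2, by have := q.2; omega⟩).image
      fun q => q.1.1) ?_ g ?_ ?_ i ?_
  · rw [hg _ rfl]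
    exact key
  · simp only [Finset.mem_image, Finset.mem_filter, Fin.mk.injEq]
    rintro k ⟨q, ⟨_, rfl⟩, rfl⟩
    exact q.2
  · simp only [Finset.mem_image, Finset.mem_filter, Fin.mk.injEq]
    rintro k ⟨q, ⟨hq, hqj⟩, rfl⟩
    rw [← hg q hqj.symm, hqj]
    exact hf q hq
  · rw [Finset.sum_image, ← h₁]
    · refine Finset.sum_congr rfl fun q hq => (hg q ?_).symm
      simp only [Finset.mem_filter, Fin.mk.injEq] at hq
      exact hq.2.symm
    · intro q hq q' hq' hqq'
      simp only [Finset.coe_filter, Set.mem_ofPred_eq, Fin.mk.injEq] at hq hq'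
      exact Subtype.ext (Prod.ext hqq' (hq.2.symm.trans hq'.2))
  · simp only [Finset.mem_image, Finset.mem_filter, Fin.mk.injEq]
    exact ⟨_, ⟨hp, rfl⟩, rfl⟩

theorem RefinedIndex.finite (d : ℕ) : Finite (RefinedIndex d) := by
  refine Set.Finite.subset
    ((Finset.range (d + 1) ×ˢ Finset.range (d + 1)).finite_toSet) fun p hp => ?_
  simp only [Finset.coe_product, Finset.coe_range, Set.mem_prod, Set.mem_Iio]
  have := hp.1
  have := hp.2
  omega

theorem end_ext_tauK (Φ : TDSystem K V d) {f g : Module.End K V}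
    (h : ∀ i j, i ≤ j → i + j ≤ d → ∀ v ∈ Φ.Ksub i,
      f (Polynomial.aeval Φ.A (Φ.tau i j) v) = g (Polynomial.aeval Φ.A (Φ.tau i j) v)) :
    f = g := by
  rw [← LinearMap.eqLocus_eq_top, eq_top_iff, ← Φ.iSup_tauK]
  refine iSup_le fun p => ?_
  rintro _ ⟨v, hv, rfl⟩
  exact h p.1.1 p.1.2 p.2.1 p.2.2 v hv

theorem existsUnique_isPsi (Φ : TDSystem K V d) : ∃! Ψ : Module.End K V, Φ.IsPsi Ψ := by
  have hinj : ∀ p : RefinedIndex d, ∃ g : V →ₗ[K] Φ.Ksub p.1.1,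
      g ∘ₗ (Polynomial.aeval Φ.A (Φ.tau p.1.1 p.1.2) ∘ₗ (Φ.Ksub p.1.1).subtype) =
        LinearMap.id := fun p => by
    refine LinearMap.exists_leftInverse_of_injective _ (LinearMap.ker_eq_bot'.2 fun v hv => ?_)
    exact Subtype.ext (eq_zero_of_aeval_tau p.2.2 (Φ.Ksub_le_split _ v.2) hv)
  choose g hg using hinj
  have := RefinedIndex.finite d
  have := Fintype.ofFinite (RefinedIndex d)
  refine existsUnique_of_exists_of_unique
    ⟨∑ p : RefinedIndex d, (Φ.vartheta p.1.2 - Φ.vartheta p.1.1) •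
      (Polynomial.aeval Φ.A (Φ.tau p.1.1 (p.1.2 - 1)) ∘ₗ (Φ.Ksub p.1.1).subtype ∘ₗ g p ∘ₗ
        TD.proj (fun p : RefinedIndex d => Φ.tauK p.1.1 p.1.2) p), ?_⟩ fun Ψ Ψ' h h' =>
    Φ.end_ext_tauK fun i j hij hijd v hv => by rw [h i j hij hijd v hv, h' i j hij hijd v hv]
  intro i j hij hijd v hv
  have hmem : Polynomial.aeval Φ.A (Φ.tau i j) v ∈ Φ.tauK i j := Submodule.mem_map_of_mem hv
  have hproj := fun p => TD.proj_apply_of_mem Φ.isInternal_tauK p ⟨(i, j), hij, hijd⟩ hmem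
  rw [LinearMap.sum_apply, Finset.sum_eq_single ⟨(i, j), hij, hijd⟩]
  · have h₁ := LinearMap.congr_fun (hg ⟨(i, j), hij, hijd⟩) ⟨v, hv⟩
    simp only [LinearMap.comp_apply, Submodule.subtype_apply, LinearMap.id_apply] at h₁
    simp only [LinearMap.smul_apply, LinearMap.comp_apply, hproj, if_true, h₁,
      Submodule.subtype_apply]
  · intro p _ hp
    simp only [LinearMap.smul_apply, LinearMap.comp_apply, hproj, if_neg hp, map_zero, smul_zero]
  · simp

end TDSystem

/-! ### Newton polynomials and lowering maps on `K[X]`. -/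

namespace TD

open Polynomial

variable {K : Type*} [Field K]

/-- The Newton polynomial `(x - a₀)(x - a₁) ⋯ (x - aₙ₋₁)`. -/
noncomputable def newton (a : ℤ → K) (n : ℕ) : K[X] := ∏ k ∈ Finset.range n, (X - C (a k))

theorem newton_zero (a : ℤ → K) : newton a 0 = 1 := rfl

theorem newton_succ (a : ℤ → K) (n : ℕ) : newton a (n + 1) = newton a n * (X - C (a n)) :=
  Finset.prod_range_succ _ _

theorem newton_monic (a : ℤ → K) (n : ℕ) : (newton a n).Monic :=
  monic_prod_of_monic _ _ fun _ _ => monic_X_sub_C _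

theorem natDegree_newton (a : ℤ → K) (n : ℕ) : (newton a n).natDegree = n := by
  rw [newton, natDegree_prod_of_monic _ _ fun _ _ => monic_X_sub_C _]
  simp

/-- The Newton polynomials as a sequence of polynomials of degrees `0, 1, 2, …`. -/
noncomputable def newtonSeq (a : ℤ → K) : Polynomial.Sequence K where
  elems' := newton a
  degree_eq' n := by
    rw [degree_eq_natDegree (newton_monic a n).ne_zero, natDegree_newton]

theorem isUnit_leadingCoeff_newtonSeq (a : ℤ → K) (n : ℕ) :
    IsUnit (newtonSeq a n).leadingCoeff := by
  rw [show newtonSeq a n = newton a n from rfl, (newton_monic a n).leadingCoeff]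
  exact isUnit_one

theorem linearMap_ext_newton {M : Type*} [AddCommGroup M] [Module K M] (a : ℤ → K)
    {f g : K[X] →ₗ[K] M} (h : ∀ n, f (newton a n) = g (newton a n)) : f = g := by
  refine LinearMap.ext_on_range ((newtonSeq a).span (isUnit_leadingCoeff_newtonSeq a)) h

theorem exists_lowering (a : ℤ → K) (s : ℕ → K) : ∃ ψ : K[X] →ₗ[K] K[X],
    ψ 1 = 0 ∧ ∀ n, ψ (newton a (n + 1)) = s (n + 1) • newton a n := by
  let b := (newtonSeq a).basis (isUnit_leadingCoeff_newtonSeq a)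
  have hb : ∀ n, b n = newton a n := Polynomial.Sequence.basis_eq_self _ _
  refine ⟨b.constr K fun n => s n • (if n = 0 then 0 else newton a (n - 1)), ?_, fun n => ?_⟩
  · rw [← newton_zero a, ← hb, Module.Basis.constr_basis]
    simp
  · rw [← hb, Module.Basis.constr_basis]
    simp

/-- Both sides are compared on the Newton basis of `a`. The coefficients of `newton a (n + 1)`,
`newton a n` and `newton a (n - 1)` match by `hsκ`, `hmid` and the invariant `hρn` of the
recurrence, respectively. -/
theorem lowering_relation {a b : ℤ → K} {β γ ρ : K}
    (ha : ∀ n, a (n + 1) = β * a n + γ - a (n - 1))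
    (hb : ∀ n, b (n + 1) = β * b n + γ - b (n - 1))
    (hρ : a 0 ^ 2 - β * (a 0 * a 1) + a 1 ^ 2 - γ * (a 0 + a 1) = ρ)
    {s : ℕ → K} (hs0 : s 0 = 0) (hs : ∀ n : ℕ, s (n + 1) = s n + (a n - b n))
    {ψ : K[X] →ₗ[K] K[X]} (hψ0 : ψ 1 = 0)
    (hψ : ∀ n, ψ (newton a (n + 1)) = s (n + 1) • newton a n) (p : K[X]) :
    ψ (X ^ 2 * p) = C β * (X * ψ (X * p)) - X ^ 2 * ψ p + C γ * (ψ (X * p) + X * ψ p) +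
      C ρ * ψ p + (C (a 1 - b 1 - (β - 1) * (a 0 - b 0)) * X +
        C ((a 0 - b 0) * (a 1 - γ) - (a 1 - b 1) * a 0)) * p := by
  have hρn : ∀ n : ℕ, a n ^ 2 - β * (a n * a (n + 1)) + a (n + 1) ^ 2 -
      γ * (a n + a (n + 1)) = ρ := fun n => by
    induction n with
    | zero => simpa using hρ
    | succ n ih =>
      have h := ha (n + 1)
      rw [add_sub_cancel_right] at h
      push_cast
      rw [h]
      linear_combination ih
  obtain ⟨κ, hκ⟩ : ∃ κ, κ = a 1 - b 1 - (β - 1) * (a 0 - b 0) := ⟨_, rfl⟩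
  obtain ⟨μ, hμ⟩ : ∃ μ, μ = (a 0 - b 0) * (a 1 - γ) - (a 1 - b 1) * a 0 := ⟨_, rfl⟩
  rw [← hκ, ← hμ]
  have hs1 : s 1 = a 0 - b 0 := by
    have := hs 0
    rwa [hs0, zero_add, zero_add] at this
  -- The constant `γ` cancels in `a - b`, so the differences of `s` satisfy the homogeneous
  -- recurrence.
  have hsκ : ∀ n : ℕ, s (n + 2) - β * s (n + 1) + s n = κ := fun n => by
    induction n with
    | zero =>
      have h₂ := hs 1
      push_cast at h₂
      linear_combination h₂ - hκ + (1 - β) * hs1 + hs0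
    | succ n ih =>
      have h₁ := hs (n + 2)
      have h₂ := hs (n + 1)
      have h₃ := hs n
      have h₄ := ha (n + 1)
      have h₅ := hb (n + 1)
      rw [add_sub_cancel_right, show (n : ℤ) + 1 + 1 = n + 2 by ring] at h₄ h₅
      push_cast at h₁ h₂
      linear_combination ih + h₁ - β * h₂ + h₃ + h₄ - h₅
  have hmid : ∀ n : ℕ, s (n + 1) * (a n + a (n + 1) - β * a n - γ) +
      s n * (a n + a (n - 1) - β * a n - γ) = κ * a n + μ := fun n => by
    induction n with
    | zero =>
      simp only [Nat.cast_zero, zero_add, hs0, hs1, hκ, hμ]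
      ring
    | succ n ih =>
      have h₁ := ha n
      have h₂ := ha (n + 1)
      have h₃ := hsκ n
      rw [add_sub_cancel_right] at h₂
      push_cast
      rw [add_sub_cancel_right]
      linear_combination ih + s (n + 2) * h₂ + (a (n + 1) - a n) * h₃ - s n * h₁
  have hX : ∀ n, X * newton a n = newton a (n + 1) + C (a n) * newton a n := fun n => by
    rw [newton_succ]
    ring
  have hX2 : ∀ n : ℕ, X ^ 2 * newton a n = newton a (n + 2) +
      C (a n + a (n + 1)) * newton a (n + 1) + C (a n ^ 2) * newton a n := fun n => by
    rw [newton_succ, newton_succ]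
    push_cast
    rw [C_add, C_pow]
    ring
  have hψC : ∀ (c : K) (q : K[X]), ψ (C c * q) = C c * ψ q := fun c q => by
    rw [← smul_eq_C_mul, map_smul, smul_eq_C_mul]
  have h : ψ ∘ₗ LinearMap.mulLeft K (X ^ 2) =
      LinearMap.mulLeft K (C β * X) ∘ₗ ψ ∘ₗ LinearMap.mulLeft K X -
        LinearMap.mulLeft K (X ^ 2) ∘ₗ ψ +
        (LinearMap.mulLeft K (C γ) ∘ₗ ψ ∘ₗ LinearMap.mulLeft K X +
          LinearMap.mulLeft K (C γ * X) ∘ₗ ψ) +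
        LinearMap.mulLeft K (C ρ) ∘ₗ ψ + LinearMap.mulLeft K (C κ * X + C μ) := by
    refine linearMap_ext_newton a fun n => ?_
    simp only [LinearMap.comp_apply, LinearMap.add_apply, LinearMap.sub_apply,
      LinearMap.mulLeft_apply, hX, hX2, map_add ψ, hψC]
    rcases n with _ | n
    · have e₁ := congrArg C (hsκ 0)
      have e₂ := congrArg C (hmid 0)
      have e₃ : newton a 1 = X - C (a 0) := by simp [newton]
      rw [newton_zero, hψ0, hψ, hψ, newton_zero, zero_add, e₃]
      simp only [hs0, smul_eq_C_mul, map_add, map_sub, map_mul, map_zero, zero_add,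
        Nat.cast_zero] at e₁ e₂ ⊢
      linear_combination (X - C (a 0)) * e₁ + e₂
    · have e₁ := congrArg C (hsκ (n + 1))
      have e₂ := congrArg C (hmid (n + 1))
      have e₃ := congrArg C (hρn n)
      rw [hψ, hψ, hψ, newton_succ a (n + 1), newton_succ a n]
      simp only [smul_eq_C_mul, map_add, map_sub, map_mul, map_pow, Nat.cast_add,
        Nat.cast_one, add_sub_cancel_right] at e₁ e₂ e₃ ⊢
      linear_combination newton a n * (X - C (a n)) * (X - C (a (n + 1))) * e₁ +
        newton a n * (X - C (a n)) * e₂ + newton a n * C (s (n + 1)) * e₃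
  have h' := LinearMap.congr_fun h p
  simp only [LinearMap.comp_apply, LinearMap.add_apply, LinearMap.sub_apply,
    LinearMap.mulLeft_apply] at h'
  rw [h']
  ring

/-- The relation is a two-step recursion for the values at the powers of `X`. -/
theorem lowering_ext {c₁ c₂ c₃ c₄ c₅ : K} {ψ ψ' : K[X] →ₗ[K] K[X]}
    (h₀ : ψ 1 = ψ' 1) (h₁ : ψ X = ψ' X)
    (h : ∀ p, ψ (X ^ 2 * p) = C c₁ * (X * ψ (X * p)) - X ^ 2 * ψ p +
      C c₂ * (ψ (X * p) + X * ψ p) + C c₃ * ψ p + (C c₄ * X + C c₅) * p)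
    (h' : ∀ p, ψ' (X ^ 2 * p) = C c₁ * (X * ψ' (X * p)) - X ^ 2 * ψ' p +
      C c₂ * (ψ' (X * p) + X * ψ' p) + C c₃ * ψ' p + (C c₄ * X + C c₅) * p) : ψ = ψ' := by
  have key : ∀ n : ℕ, ψ (X ^ n) = ψ' (X ^ n) ∧ ψ (X ^ (n + 1)) = ψ' (X ^ (n + 1)) := fun n => by
    induction n with
    | zero => simpa using ⟨h₀, h₁⟩
    | succ n ih =>
      refine ⟨ih.2, ?_⟩
      have e := h (X ^ n)
      have e' := h' (X ^ n)
      rw [← pow_succ', ← pow_add, add_comm 2 n] at e e'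
      rw [e, e', ih.1, ih.2]
  refine Polynomial.lhom_ext' fun n => LinearMap.ext_ring ?_
  simpa [monomial_one_right_eq_X_pow] using (key n).1

/-- If `ψ` lowers the Newton polynomials of `θᵢ, θᵢ₊₁, …` with coefficients `s`, then it also
lowers the Newton polynomials of `θₑ, θₑ₋₁, …` with the same coefficients. -/
theorem lowering_newton_reverse {θ : ℤ → K} {β γ : K}
    (hθ : ∀ n, θ (n + 1) = β * θ n + γ - θ (n - 1)) (i e : ℤ) {s : ℕ → K} (hs0 : s 0 = 0)
    (hs : ∀ n : ℕ, s (n + 1) = s n + (θ (i + n) - θ (e - n))) {ψ : K[X] →ₗ[K] K[X]}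
    (hψ0 : ψ 1 = 0)
    (hψ : ∀ n, ψ (newton (fun k => θ (i + k)) (n + 1)) =
      s (n + 1) • newton (fun k => θ (i + k)) n) (n : ℕ) :
    ψ (newton (fun k => θ (e - k)) (n + 1)) = s (n + 1) • newton (fun k => θ (e - k)) n := by
  obtain ⟨ψ', hψ0', hψ'⟩ := exists_lowering (fun k => θ (e - k)) s
  have hinv : ∀ j : ℤ, θ j ^ 2 - β * (θ j * θ (j + 1)) + θ (j + 1) ^ 2 - γ * (θ j + θ (j + 1)) =
      θ 0 ^ 2 - β * (θ 0 * θ 1) + θ 1 ^ 2 - γ * (θ 0 + θ 1) := fun j => by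
    induction j using Int.induction_on with
    | zero => simp
    | succ j ih =>
      have h := hθ (j + 1)
      rw [add_sub_cancel_right] at h
      rw [← ih, h]
      ring
    | pred j ih =>
      have h := hθ (-j)
      rw [← ih, h, sub_add_cancel]
      ring
  have ha : ∀ n, θ (i + (n + 1)) = β * θ (i + n) + γ - θ (i + (n - 1)) := fun n => by
    rw [← add_assoc, hθ, add_sub_assoc i]
  have hb : ∀ n, θ (e - (n + 1)) = β * θ (e - n) + γ - θ (e - (n - 1)) := fun n => by
    have := hθ (e - n)
    rw [show e - (n + 1) = e - n - 1 by ring, show e - (n - 1) = e - n + 1 by ring, this]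
    ring
  have h := lowering_relation (a := fun k => θ (i + k)) (b := fun k => θ (e - k)) ha hb
    (by simpa using hinv i) hs0 hs hψ0 hψ
  -- Exchanging the two sequences changes the sign of `s`, hence `-ψ'`. After undoing the sign, the
  -- inhomogeneous term is unchanged, since `(a₀ - b₀)a₁ - (a₁ - b₁)a₀` is symmetric up to sign
  -- under the exchange.
  have hneg : ∀ n, (-ψ') (newton (fun k => θ (e - k)) (n + 1)) =
      (fun m => -s m) (n + 1) • newton (fun k => θ (e - k)) n := fun n => by
    simp [hψ']
  have h' := lowering_relation (a := fun k => θ (e - k)) (b := fun k => θ (i + k))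
    (s := fun m => -s m) (ψ := -ψ') hb ha
    (ρ := θ 0 ^ 2 - β * (θ 0 * θ 1) + θ 1 ^ 2 - γ * (θ 0 + θ 1))
    (by
      have := hinv (e - 1)
      rw [sub_add_cancel] at this
      rw [sub_zero]
      linear_combination this)
    (by simp [hs0]) (fun n => by simp only [hs]; ring) (by simp [hψ0']) hneg
  suffices hψψ : ψ = ψ' by rw [hψψ, hψ']
  have hs1 : s 1 = θ i - θ e := by simpa [hs0] using hs 0
  have hb1 : newton (fun k => θ (e - k)) 1 = X - C (θ e) := by simp [newton]
  have ha1 : newton (fun k => θ (i + k)) 1 = X - C (θ i) := by simp [newton]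
  have hC : ∀ (φ : K[X] →ₗ[K] K[X]) (c : K), φ 1 = 0 → φ (C c) = 0 := fun φ c h => by
    rw [← mul_one (C c), ← smul_eq_C_mul, map_smul, h, smul_zero]
  refine lowering_ext (hψ0.trans hψ0'.symm) ?_ h fun p => ?_
  · have h₁ := hψ 0
    have h₂ := hψ' 0
    rw [zero_add, newton_zero, ha1, map_sub, hC _ _ hψ0, sub_zero] at h₁
    rw [zero_add, newton_zero, hb1, map_sub, hC _ _ hψ0', sub_zero] at h₂
    rw [h₁, h₂]
  · have e₁ := h' p
    simp only [LinearMap.neg_apply, map_sub, map_mul, map_one] at e₁ ⊢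
    linear_combination -e₁

end TD

/-! ### The three-term recurrence for the eigenvalues. -/

namespace TDSystem

variable {K V : Type*} [Field K] [AddCommGroup V] [Module K V] {d : ℕ} {Φ : TDSystem K V d}

theorem lowStar_one_le_split_zero (Φ : TDSystem K V d) : Φ.lowStar 1 ≤ Φ.split 0 := fun _ hv =>
  ⟨hv, mem_high.2 fun _ hh => absurd hh (Nat.not_lt_zero _)⟩

theorem exists_ne_zero_mem_lowStar_one (Φ : TDSystem K V d) : ∃ v ∈ Φ.lowStar 1, v ≠ 0 := by
  have h := Φ.dual.E_ne_zero 0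
  obtain ⟨v, hv⟩ : ∃ v, Φ.Estar 0 v ≠ 0 := by
    by_contra! h'
    exact h (LinearMap.ext h')
  refine ⟨_, mem_lowStar.2 fun i hi => ?_, hv⟩
  refine (Φ.dual.E_apply_E i 0 v).trans (if_neg ?_)
  rintro rfl
  simp at hi

/-- For `0 ≠ v ∈ E₀*V` and `p` of degree `k ≤ d`, the component of `p(A)v` in `Eₖ*V` is nonzero. -/
theorem Estar_aeval_ne_zero {v : V} (hv : v ∈ Φ.lowStar 1) (hv0 : v ≠ 0) {p : K[X]}
    (hp0 : p ≠ 0) {k : Fin (d + 1)} (hp : p.natDegree = k) :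
    Φ.Estar k (Polynomial.aeval Φ.A p v) ≠ 0 := by
  intro h
  obtain ⟨c, hc⟩ : ∃ c, c = p.leadingCoeff := ⟨_, rfl⟩
  have hc0 : c ≠ 0 := hc ▸ Polynomial.leadingCoeff_ne_zero.2 hp0
  have hmon : (Polynomial.C c⁻¹ * p).Monic := by
    rw [hc, mul_comm]
    exact Polynomial.monic_mul_leadingCoeff_inv hp0
  have hdeg : (Φ.tau 0 k).natDegree = k := by
    rw [natDegree_tau Φ 0 (by omega), Nat.sub_zero]
  have hsub := aeval_sub_mem_lowStar (n := 0) hv (Φ.tau_monic 0 k) hmon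
    (by rw [hdeg, Polynomial.natDegree_C_mul (inv_ne_zero hc0), hp])
  rw [hdeg, zero_add] at hsub
  have h₁ := mem_lowStar.1 hsub k le_rfl
  rw [map_sub, map_mul, Module.End.mul_apply, Polynomial.aeval_C, Module.algebraMap_end_apply,
    map_smul, h, smul_zero, sub_zero] at h₁
  have h₂ := aeval_tau_mem_split (Nat.zero_le k) (by omega) (Φ.lowStar_one_le_split_zero hv)
  have h₃ : Polynomial.aeval Φ.A (Φ.tau 0 k) v ∈ Φ.lowStar k ⊓ Φ.high k := by
    refine ⟨mem_lowStar.2 fun i hi => ?_, h₂.2⟩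
    rcases hi.eq_or_lt with hi | hi
    · rwa [← Fin.ext hi]
    · exact mem_lowStar.1 h₂.1 i hi
  rw [lowStar_inf_high, Submodule.mem_bot] at h₃
  exact hv0 (eq_zero_of_aeval_tau (by omega) (Φ.lowStar_one_le_split_zero hv) h₃)

/-- If `p` interpolates a sequence with differences `θᵢ₋₁ θᵢ (θᵢ₋₁ - θᵢ)`, then
`A²A*A - AA*A² = p(A)A* - A*p(A)`. -/
theorem commutator_eq {p : K[X]} (hp : ∀ i j : Fin (d + 1), (j : ℕ) = i + 1 →
      p.eval (Φ.theta i) - p.eval (Φ.theta j) =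
        Φ.theta i * Φ.theta j * (Φ.theta i - Φ.theta j)) (v : V) :
    Φ.A (Φ.A (Φ.Astar (Φ.A v))) - Φ.A (Φ.Astar (Φ.A (Φ.A v))) =
      Polynomial.aeval Φ.A p (Φ.Astar v) - Φ.Astar (Polynomial.aeval Φ.A p v) := by
  have hE : ∀ (j : Fin (d + 1)) (q : K[X]) (w : V),
      Polynomial.aeval Φ.A q (Φ.E j w) = q.eval (Φ.theta j) • Φ.E j w := fun j q w =>
    Φ.ext_E fun i => by
      rw [E_apply_aeval, map_smul, E_apply_E]
      split_ifs with h
      · rw [h]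
      · simp
  have key : ∀ (j : Fin (d + 1)) (v : V), v ∈ Φ.A.eigenspace (Φ.theta j) →
      (Φ.A * Φ.A * Φ.Astar * Φ.A - Φ.A * Φ.Astar * Φ.A * Φ.A) v =
      (Polynomial.aeval Φ.A p * Φ.Astar - Φ.Astar * Polynomial.aeval Φ.A p) v := by
    intro j v hv
    rw [← Φ.range_E] at hv
    obtain ⟨w, rfl⟩ := hv
    refine Φ.ext_E fun i => ?_
    simp only [LinearMap.sub_apply, Module.End.mul_apply, A_apply_E, map_smul, map_sub, hE,
      E_apply_A, E_apply_aeval, smul_smul, ← sub_smul]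
    -- Between `EᵢV` and `EⱼV` the two sides multiply `EᵢA*Eⱼ` by `θᵢθⱼ(θᵢ - θⱼ)` and by `p(θᵢ) -
    -- p(θⱼ)`; these only need to agree for `|i - j| ≤ 1`.
    by_cases hij : (i : ℕ) ≤ j + 1 ∧ (j : ℕ) ≤ i + 1
    · congr 1
      rcases lt_trichotomy (i : ℕ) j with h | h | h
      · rw [hp i j (by omega)]
        ring
      · rw [Fin.ext h]
        ring
      · have := hp j i (by omega)
        linear_combination this
    · rw [Φ.E_Astar_E i j hij, smul_zero, smul_zero]
  exact LinearMap.congr_fun (Φ.end_ext key) v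

theorem exists_interpolation (Φ : TDSystem K V d) : ∃ p : K[X], p.natDegree ≤ d ∧
    ∀ i j : Fin (d + 1), (j : ℕ) = i + 1 → p.eval (Φ.theta i) - p.eval (Φ.theta j) =
        Φ.theta i * Φ.theta j * (Φ.theta i - Φ.theta j) := by
  let t : ℕ → K := fun k => if h : k < d + 1 then Φ.theta ⟨k, h⟩ else 0
  have ht : ∀ i : Fin (d + 1), t i = Φ.theta i := fun i => dif_pos i.isLt
  let r : Fin (d + 1) → K := fun i =>
    -∑ k ∈ Finset.range i, t k * t (k + 1) * (t k - t (k + 1))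
  have hinj : Set.InjOn Φ.theta (Finset.univ : Finset (Fin (d + 1))) :=
    Φ.standard.injective.injOn
  refine ⟨Lagrange.interpolate Finset.univ Φ.theta r, ?_, fun i j hij => ?_⟩
  · have := Lagrange.degree_interpolate_le (r := r) hinj
    rw [Finset.card_univ, Fintype.card_fin, Nat.add_sub_cancel] at this
    exact Polynomial.natDegree_le_of_degree_le this
  · rw [Lagrange.eval_interpolate_at_node r hinj (Finset.mem_univ i),
      Lagrange.eval_interpolate_at_node r hinj (Finset.mem_univ j), ← ht i, ← ht j]
    simp only [r, hij, Finset.sum_range_succ]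
    ring

/-- Apply the commutator identity to `0 ≠ v ∈ E₀*V`. The left side is `(θ₁* - θ₂*)A³v` modulo `E₀*V
+ E₁*V + E₂*V`, while the `Eₖ*V`-component of the right side is `(θ₀* - θₖ*)Eₖ*p(A)v`, nonzero for
`k = deg p ≥ 1`. Degree above 3 contradicts the first, and a vanishing cubic coefficient contradicts
`E₃*A³v ≠ 0`. -/
theorem natDegree_and_coeff (hd : 3 ≤ d) {p : K[X]} (hpd : p.natDegree ≤ d)
    (hp : ∀ i j : Fin (d + 1), (j : ℕ) = i + 1 → p.eval (Φ.theta i) - p.eval (Φ.theta j) =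
        Φ.theta i * Φ.theta j * (Φ.theta i - Φ.theta j)) :
    p.natDegree ≤ 3 ∧ p.coeff 3 ≠ 0 := by
  obtain ⟨v, hv, hv0⟩ := Φ.exists_ne_zero_mem_lowStar_one
  have hA : ∀ {n : ℕ} {w : V}, w ∈ Φ.lowStar n → Φ.A w ∈ Φ.lowStar (n + 1) := A_mem_lowStar
  have hAs : ∀ (n : ℕ) (hn : n < d + 1) {w : V}, w ∈ Φ.lowStar (n + 1) →
      Φ.Astar w - Φ.thetaStar ⟨n, hn⟩ • w ∈ Φ.lowStar n := fun n hn w hw =>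
    Astar_sub_mem_lowStar (n := ⟨n, hn⟩) hw
  have hcomm := Φ.commutator_eq hp v
  have hv' : Φ.Astar v = Φ.thetaStar 0 • v := by
    have := hAs 0 (by omega) hv
    rw [lowStar_zero, Submodule.mem_bot, sub_eq_zero] at this
    exact this
  have hR : ∀ k : Fin (d + 1),
      Φ.Estar k (Polynomial.aeval Φ.A p (Φ.Astar v) - Φ.Astar (Polynomial.aeval Φ.A p v)) =
      (Φ.thetaStar 0 - Φ.thetaStar k) • Φ.Estar k (Polynomial.aeval Φ.A p v) := fun k => by
    rw [map_sub, hv', map_smul, map_smul, sub_smul]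
    congr 1
    exact Φ.dual.E_apply_A k _
  have h₁ : Φ.A (Φ.A (Φ.Astar (Φ.A v))) - Φ.thetaStar ⟨1, by omega⟩ • Φ.A (Φ.A (Φ.A v)) ∈
      Φ.lowStar 3 := by
    have := hA (hA (hAs 1 (by omega) (hA hv)))
    simpa only [map_sub, map_smul] using this
  have h₂ : Φ.A (Φ.Astar (Φ.A (Φ.A v))) - Φ.thetaStar ⟨2, by omega⟩ • Φ.A (Φ.A (Φ.A v)) ∈
      Φ.lowStar 3 := by
    have := hA (hAs 2 (by omega) (hA (hA hv)))
    simpa only [map_sub, map_smul] using this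
  have h₃ := hA (hA (hA hv))
  have hL : Φ.A (Φ.A (Φ.Astar (Φ.A v))) - Φ.A (Φ.Astar (Φ.A (Φ.A v))) -
      (Φ.thetaStar ⟨1, by omega⟩ - Φ.thetaStar ⟨2, by omega⟩) • Φ.A (Φ.A (Φ.A v)) ∈
      Φ.lowStar 3 := by
    have := sub_mem h₁ h₂
    convert this using 1
    rw [sub_smul]
    abel
  have hne : ∀ i j : Fin (d + 1), i ≠ j → Φ.thetaStar i - Φ.thetaStar j ≠ 0 := fun i j hij =>
    sub_ne_zero.2 fun h => hij (Φ.standard_star.injective h)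
  have hdeg : p.natDegree ≤ 3 := by
    by_contra! hlt
    have hk : p.natDegree < d + 1 := by omega
    have h0 : Φ.Estar ⟨p.natDegree, hk⟩
        (Polynomial.aeval Φ.A p (Φ.Astar v) - Φ.Astar (Polynomial.aeval Φ.A p v)) = 0 := by
      rw [← hcomm]
      have := add_mem (lowStar_mono (show 3 ≤ 4 by omega) hL)
        (Submodule.smul_mem _ (Φ.thetaStar ⟨1, by omega⟩ - Φ.thetaStar ⟨2, by omega⟩) h₃)
      rw [sub_add_cancel] at this
      exact mem_lowStar.1 this _ hlt
    rw [hR] at h0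
    refine Estar_aeval_ne_zero hv hv0 (p := p) ?_ rfl ((smul_eq_zero.1 h0).resolve_left ?_)
    · rintro rfl
      simp at hlt
    · refine hne _ _ fun h => ?_
      have := congrArg Fin.val h
      simp only [Fin.val_zero] at this
      omega
  refine ⟨hdeg, fun hc => ?_⟩
  have hlt : p.natDegree ≤ 2 := by
    by_contra! hlt
    have h3 : p.natDegree = 3 := by omega
    rw [← h3, Polynomial.coeff_natDegree, Polynomial.leadingCoeff_eq_zero] at hc
    rw [hc] at h3
    simp at h3
  have h0 := mem_lowStar.1 hL ⟨3, by omega⟩ le_rfl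
  rw [hcomm, map_sub, hR, mem_lowStar.1 (aeval_mem_lowStar hv hlt) ⟨3, by omega⟩ le_rfl,
    smul_zero, zero_sub, neg_eq_zero, map_smul] at h0
  have h0' := (smul_eq_zero.1 h0).resolve_left (hne _ _ (by simp))
  refine Estar_aeval_ne_zero hv hv0 (p := Polynomial.X ^ 3) (k := ⟨3, by omega⟩)
    (pow_ne_zero _ Polynomial.X_ne_zero) (by simp) ?_
  rw [map_pow, Polynomial.aeval_X]
  exact h0'

theorem exists_recurrence_fin (Φ : TDSystem K V d) : ∃ β γ : K, ∀ i j k : Fin (d + 1),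
    (j : ℕ) = i + 1 → (k : ℕ) = j + 1 → Φ.theta k = β * Φ.theta j + γ - Φ.theta i := by
  rcases lt_or_ge d 3 with hd | hd
  · rcases lt_or_ge d 2 with hd2 | hd2
    · exact ⟨0, 0, fun i j k hij hjk => by omega⟩
    · refine ⟨0, Φ.theta ⟨2, by omega⟩ + Φ.theta ⟨0, by omega⟩, fun i j k hij hjk => ?_⟩
      rw [show k = ⟨2, by omega⟩ from Fin.ext (by simp only; omega),
        show i = ⟨0, by omega⟩ from Fin.ext (by simp only; omega)]
      ring
  · obtain ⟨p, hpd, hp⟩ := Φ.exists_interpolation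
    obtain ⟨hdeg, hc⟩ := natDegree_and_coeff hd hpd hp
    have heval : ∀ x, p.eval x =
        p.coeff 0 + p.coeff 1 * x + p.coeff 2 * x ^ 2 + p.coeff 3 * x ^ 3 := fun x => by
      rw [Polynomial.eval_eq_sum_range' (Nat.lt_succ_of_le hdeg)]
      simp [Finset.sum_range_succ]
    have hne : ∀ i j : Fin (d + 1), (i : ℕ) < j → Φ.theta i - Φ.theta j ≠ 0 := fun i j hij =>
      sub_ne_zero.2 fun h => hij.ne (congrArg Fin.val (Φ.standard.injective h))
    have hinv : ∀ i j : Fin (d + 1), (j : ℕ) = i + 1 → Φ.theta i * Φ.theta j =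
        p.coeff 3 * (Φ.theta i ^ 2 + Φ.theta i * Φ.theta j + Φ.theta j ^ 2) +
          p.coeff 2 * (Φ.theta i + Φ.theta j) + p.coeff 1 := fun i j hij => by
      refine mul_right_cancel₀ (hne i j (by omega)) ?_
      rw [← hp i j hij, heval, heval]
      ring
    -- Cancelling `θᵢ - θⱼ` gives `hinv`; subtracting two consecutive instances and cancelling `θᵢ -
    -- θₖ` gives `θⱼ = c₃(θᵢ + θⱼ + θₖ) + c₂`, which is solved for `θₖ`.
    refine ⟨(p.coeff 3)⁻¹ - 1, -(p.coeff 3)⁻¹ * p.coeff 2, fun i j k hij hjk => ?_⟩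
    have h₁ := hinv i j hij
    have h₂ := hinv j k hjk
    have h₃ : Φ.theta j = p.coeff 3 * (Φ.theta i + Φ.theta j + Φ.theta k) + p.coeff 2 := by
      refine mul_right_cancel₀ (hne i k (by omega)) ?_
      linear_combination h₁ - h₂
    field_simp
    linear_combination -h₃

/-- The step `(tₙ, tₙ₊₁) ↦ (tₙ₊₁, tₙ₊₂)` is a permutation of `K × K`, so it can be iterated in both
directions. -/
theorem exists_int_recurrence (β γ x y : K) : ∃ t : ℤ → K, t 0 = x ∧ t 1 = y ∧
    ∀ n, t (n + 1) = β * t n + γ - t (n - 1) := by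
  let e : Equiv.Perm (K × K) :=
    { toFun := fun q => (q.2, β * q.2 + γ - q.1)
      invFun := fun q => (β * q.1 + γ - q.2, q.1)
      left_inv := fun q => Prod.ext (by simp) rfl
      right_inv := fun q => Prod.ext rfl (by simp) }
  have he : ∀ n : ℤ, (e ^ (n + 1)) (x, y) = e ((e ^ n) (x, y)) := fun n => by
    rw [add_comm, zpow_one_add, Equiv.Perm.mul_apply]
  have h₂ : ∀ n : ℤ, ((e ^ n) (x, y)).2 = ((e ^ (n + 1)) (x, y)).1 := fun n => by
    rw [he]
    rfl
  refine ⟨fun n => ((e ^ n) (x, y)).1, rfl, rfl, fun n => ?_⟩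
  have h₃ := he (n - 1)
  have h₄ := h₂ (n - 1)
  rw [sub_add_cancel] at h₃ h₄
  have h₅ : ((e ^ n) (x, y)).2 =
      β * ((e ^ (n - 1)) (x, y)).2 + γ - ((e ^ (n - 1)) (x, y)).1 := by
    rw [h₃]
    rfl
  beta_reduce
  rw [← h₂, h₅, h₄]

/-- The eigenvalue sequence of a TD system extends to a sequence on `ℤ` that satisfies a linear
recurrence. -/
theorem exists_theta_int (hd : 1 ≤ d) (Φ : TDSystem K V d) : ∃ (t : ℤ → K) (β γ : K),
    (∀ i : Fin (d + 1), t (i : ℕ) = Φ.theta i) ∧ ∀ n, t (n + 1) = β * t n + γ - t (n - 1) := by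
  obtain ⟨β, γ, h⟩ := Φ.exists_recurrence_fin
  obtain ⟨t, h0, h1, ht⟩ := exists_int_recurrence β γ (Φ.theta 0) (Φ.theta ⟨1, by omega⟩)
  refine ⟨t, β, γ, ?_, ht⟩
  rintro ⟨n, hn⟩
  induction n using Nat.strong_induction_on with
  | _ n ih =>
  rcases n with _ | _ | n
  · exact h0
  · exact h1
  · rw [h ⟨n, by omega⟩ ⟨n + 1, by omega⟩ ⟨n + 1 + 1, hn⟩ rfl rfl, ← ih n (by omega) (by omega),
      ← ih (n + 1) (by omega) (by omega)]
    have := ht (n + 1)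
    rw [add_sub_cancel_right] at this
    exact_mod_cast this

end TDSystem

/-! ### `Δ` and `Ψ` in terms of Newton polynomials, and their commutation. -/

namespace TDSystem

variable {K V : Type*} [Field K] [AddCommGroup V] [Module K V] {d : ℕ} {Φ : TDSystem K V d}

/-- `Kᵢ` is unchanged by reversing the eigenspaces of `A`, so the right side lies in `Uⱼ^⇓`; the two
monic polynomials have equal degree, so the vectors agree modulo `E₀*V + ⋯ + Eⱼ₋₁*V`. -/
theorem Delta_aeval_tau {i j : ℕ} (hij : i ≤ j) (hj : j ≤ d) {v : V} (hv : v ∈ Φ.Ksub i) :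
    Φ.Delta (Polynomial.aeval Φ.A (Φ.tau i j) v) =
      Polynomial.aeval Φ.A (Φ.down.tau i j) v := by
  refine Φ.Delta_apply ⟨j, by omega⟩ ?_ ?_ ?_
  · rw [U_eq]
    exact aeval_tau_mem_split hij (by omega) (Φ.Ksub_le_split i hv)
  · rw [U_eq]
    exact aeval_tau_mem_split (Φ := Φ.down) hij (by omega)
      (Φ.down.Ksub_le_split i (by rwa [down_Ksub]))
  · have hdeg := Φ.natDegree_tau i (show j ≤ d + 1 by omega)
    have := aeval_sub_mem_lowStar (mem_Ksub.1 hv).1 (Φ.tau_monic i j) (Φ.down.tau_monic i j)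
      (by rw [hdeg, natDegree_tau _ _ (by omega)])
    rwa [hdeg, Nat.add_sub_cancel' hij] at this

theorem tau_eq_newton {t : ℤ → K} (ht : ∀ i : Fin (d + 1), t (i : ℕ) = Φ.theta i) {i n : ℕ}
    (h : i + n ≤ d + 1) : Φ.tau i (i + n) = TD.newton (fun k => t (i + k)) n := by
  rw [tau_eq_prod_Ico (fun k => t k) ht i h, Finset.prod_Ico_eq_prod_range, TD.newton,
    Nat.add_sub_cancel_left]
  push_cast
  rfl

theorem theta_rev_eq {t : ℤ → K} (ht : ∀ i : Fin (d + 1), t (i : ℕ) = Φ.theta i)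
    (i : Fin (d + 1)) : t (d - (i : ℕ)) = Φ.theta i.rev := by
  rw [← ht, Fin.val_rev]
  congr 1
  omega

theorem down_tau_eq_newton {t : ℤ → K} (ht : ∀ i : Fin (d + 1), t (i : ℕ) = Φ.theta i)
    {i n : ℕ} (h : i + n ≤ d + 1) :
    Φ.down.tau i (i + n) = TD.newton (fun k => t ((d : ℤ) - i - k)) n := by
  rw [tau_eq_newton (Φ := Φ.down) (t := fun k => t (d - k)) (theta_rev_eq ht) h]
  simp only [sub_sub]

theorem vartheta_eq {t : ℤ → K} (ht : ∀ i : Fin (d + 1), t (i : ℕ) = Φ.theta i) {n : ℕ}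
    (hn : n ≤ d + 1) : Φ.vartheta n = (Φ.theta 0 - Φ.theta (Fin.last d))⁻¹ *
      ∑ k ∈ Finset.range n, (t (k : ℕ) - t (d - (k : ℕ))) := by
  rw [vartheta, Finset.sum_filter, Finset.mul_sum]
  simp only [← theta_rev_eq ht]
  simp only [← ht]
  rw [Fin.sum_univ_eq_sum_range (fun k => if k < n then (t (k : ℕ) - t (d - (k : ℕ))) /
    (t ((0 : Fin (d + 1)) : ℕ) - t ((Fin.last d : Fin (d + 1)) : ℕ)) else 0),
    ← Finset.sum_filter]
  refine Finset.sum_congr ?_ fun k _ => by rw [div_eq_inv_mul]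
  ext k
  simp only [Finset.mem_filter, Finset.mem_range]
  omega

theorem vartheta_sub_vartheta {t : ℤ → K} (ht : ∀ i : Fin (d + 1), t (i : ℕ) = Φ.theta i)
    {i n : ℕ} (h : i + n ≤ d + 1) : Φ.vartheta (i + n) - Φ.vartheta i =
      (Φ.theta 0 - Φ.theta (Fin.last d))⁻¹ *
        ∑ k ∈ Finset.range n, (t (i + k) - t ((d : ℤ) - i - k)) := by
  rw [vartheta_eq ht h, vartheta_eq ht (by omega), ← mul_sub, Finset.sum_range_add,
    add_sub_cancel_left]
  push_cast
  simp only [sub_sub]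

theorem aeval_newton_Ksub {t : ℤ → K} (ht : ∀ i : Fin (d + 1), t (i : ℕ) = Φ.theta i)
    {i n : ℕ} (hi : i + i ≤ d) (hn : d + 1 - (i + i) ≤ n) {v : V} (hv : v ∈ Φ.Ksub i) :
    Polynomial.aeval Φ.A (TD.newton (fun k => t (i + k)) n) v = 0 := by
  induction n, hn using Nat.le_induction with
  | base =>
    rw [← tau_eq_newton ht (by omega), show i + (d + 1 - (i + i)) = d + 1 - i by omega,
      aeval_tau_Ksub hv]
  | succ n _ ih => rw [TD.newton_succ, mul_comm, aeval_mul_apply, ih, map_zero]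

/-- On the cyclic `K[A]`-module generated by a vector of `Kᵢ`, the map `Ψ` is induced by a lowering
map on polynomials. -/
theorem isPsi_apply_aeval {t : ℤ → K} (ht : ∀ i : Fin (d + 1), t (i : ℕ) = Φ.theta i)
    {Ψ : Module.End K V} (hΨ : Φ.IsPsi Ψ) {i : ℕ} (hi : i + i ≤ d) {v : V} (hv : v ∈ Φ.Ksub i)
    {ψ : K[X] →ₗ[K] K[X]} (hψ0 : ψ 1 = 0)
    (hψ : ∀ n, ψ (TD.newton (fun k => t (i + k)) (n + 1)) =
      (∑ k ∈ Finset.range (n + 1), (t (i + k) - t ((d : ℤ) - i - k))) •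
        TD.newton (fun k => t (i + k)) n) (p : K[X]) :
    Ψ (Polynomial.aeval Φ.A p v) =
      (Φ.theta 0 - Φ.theta (Fin.last d))⁻¹ • Polynomial.aeval Φ.A (ψ p) v := by
  let ev : K[X] →ₗ[K] V := (LinearMap.applyₗ v) ∘ₗ (Polynomial.aeval Φ.A).toLinearMap
  have h : Ψ ∘ₗ ev = (Φ.theta 0 - Φ.theta (Fin.last d))⁻¹ • (ev ∘ₗ ψ) := by
    refine TD.linearMap_ext_newton (fun k => t (i + k)) fun n => ?_
    change Ψ (Polynomial.aeval Φ.A (TD.newton (fun k => t (i + k)) n) v) =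
      (Φ.theta 0 - Φ.theta (Fin.last d))⁻¹ • Polynomial.aeval Φ.A (ψ (TD.newton (fun k => t (i + k)) n)) v
    rcases n with _ | n
    · have := hΨ i i le_rfl hi v hv
      rw [sub_self, zero_smul, tau_self] at this
      rw [TD.newton_zero, this, hψ0, map_zero, LinearMap.zero_apply, smul_zero]
    · rw [hψ, map_smul, LinearMap.smul_apply, smul_smul]
      by_cases hn : i + (i + (n + 1)) ≤ d
      · have := hΨ i (i + (n + 1)) (by omega) hn v hv
        rw [vartheta_sub_vartheta ht (by omega), tau_eq_newton ht (by omega),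
          show i + (n + 1) - 1 = i + n by omega, tau_eq_newton ht (by omega)] at this
        exact this
      · rw [aeval_newton_Ksub ht hi (by omega) hv, map_zero]
        -- Here the Newton polynomial of degree `n + 1` already kills `v`. In the boundary case `n =
        -- d - 2i` the coefficient vanishes, as its sum is antisymmetric under `k ↦ n - k`; for
        -- larger `n` the polynomial of degree `n` kills `v` too.
        rcases lt_or_ge n (d + 1 - (i + i)) with hlt | hge
        · have h0 : ∑ k ∈ Finset.range (n + 1), (t (i + k) - t ((d : ℤ) - i - k)) = 0 := by
            rw [Finset.sum_sub_distrib, sub_eq_zero, ← Finset.sum_range_reflect]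
            refine Finset.sum_congr rfl fun k hk => ?_
            have := Finset.mem_range.1 hk
            congr 1
            omega
          rw [h0, mul_zero, zero_smul]
        · rw [aeval_newton_Ksub ht hi hge hv, smul_zero]
  exact LinearMap.congr_fun h p

theorem Delta_mul_comm_of_isPsi (hd : 1 ≤ d) (Φ : TDSystem K V d) {Ψ : Module.End K V}
    (hΨ : Φ.IsPsi Ψ) : Φ.Delta * Ψ = Ψ * Φ.Delta := by
  obtain ⟨t, β, γ, ht, hrec⟩ := exists_theta_int hd Φ
  refine Φ.end_ext_tauK fun i j hij hijd v hv => ?_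
  obtain ⟨n, rfl⟩ := Nat.exists_eq_add_of_le hij
  rw [Module.End.mul_apply, Module.End.mul_apply, Delta_aeval_tau hij (by omega) hv,
    hΨ i _ hij hijd v hv, map_smul]
  obtain ⟨ψ, hψ0, hψ⟩ := TD.exists_lowering (fun k => t (i + k))
    fun n => ∑ k ∈ Finset.range n, (t (i + k) - t ((d : ℤ) - i - k))
  have hψ' := TD.lowering_newton_reverse hrec i ((d : ℤ) - i)
    (s := fun n => ∑ k ∈ Finset.range n, (t (i + k) - t ((d : ℤ) - i - k)))
    (Finset.sum_range_zero _) (fun n => Finset.sum_range_succ _ n) hψ0 hψ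
  rw [isPsi_apply_aeval ht hΨ (by omega) hv hψ0 hψ]
  rcases n with _ | n
  · rw [add_zero, sub_self, zero_smul, tau_self, hψ0, map_zero, LinearMap.zero_apply, smul_zero]
  · rw [show i + (n + 1) - 1 = i + n by omega, Delta_aeval_tau (by omega) (by omega) hv,
      down_tau_eq_newton ht (by omega), down_tau_eq_newton ht (by omega), hψ', map_smul,
      LinearMap.smul_apply, smul_smul, vartheta_sub_vartheta ht (by omega)]

end TDSystem

theorem mainTheorem1 {K V : Type*} [Field K] [AddCommGroup V] [Module K V]
    {d : ℕ} (hd : 1 ≤ d) (Φ : TDSystem K V d) :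
    -- the first split decomposition, the second one and the refined one are decompositions of `V`
    DirectSum.IsInternal Φ.U ∧
    DirectSum.IsInternal Φ.Udd ∧
    DirectSum.IsInternal
      (fun p : TDSystem.RefinedIndex d => Φ.tauK p.1.1 p.1.2) ∧
    -- there is exactly one `Ψ` with the defining property, and it commutes with `Δ`
    (∃! Ψ : Module.End K V, Φ.IsPsi Ψ) ∧
    ∀ Ψ : Module.End K V, Φ.IsPsi Ψ → Φ.Delta * Ψ = Ψ * Φ.Delta := by
  exact ⟨Φ.isInternal_U, Φ.Udd_eq ▸ Φ.down.isInternal_U, Φ.isInternal_tauK,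
    Φ.existsUnique_isPsi, fun _ hΨ => Φ.Delta_mul_comm_of_isPsi hd hΨ⟩
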